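/- Let $(D,\mathcal D,\varrho)$ be a probability space and let $\mu$ be a probability measure on $D$ with $\mu\ll\varrho$. Put $v=d\mu/d\varrho$ and $w=1/v:D\to[0,\infty]$. Let $\mathcal P$ be an $n$-dimensional complex vector space of functions $D\to\mathbb C$, all of them square-integrable with respect to $\varrho$, that contains a function equal to $1$ $\varrho$-almost everywhere. (An $n$-dimensional subspace of $L^2_\varrho(D)$ is regarded as such a space by fixing representatives of a basis.) Let $\Omega\subseteq D$ be a $\varrho$-measurable set with $\varrho(\Omega)>0$ such that $v>0$ almost everywhere on $\Omega$; norms over $\Omega$ are taken with respect to the restriction $\varrho|_\Omega$. Define $$\mathcal K_\Omega(x)=\sup\{|p(x)|^2:\ p\in\mathcal P,\ \|p\|^2_{L^2_\varrho(\Omega)}=1\},\qquad \kappa_w=\operatorname*{ess\,sup}_{x\sim\varrho|_\Omega} w(x)\,\mathcal K_\Omega(x),$$ and, for $q\in\{2,\infty\}$, $$\mathcal R_q=\sup\{\|p\|_{L^q_\varrho(D)}:\ p\in\mathcal P,\ 0<\|p\|_{L^2_\varrho(\Omega)}\le 1\}\in[0,\infty].$$ Let $f:D\to\mathbb C$ be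 square-integrable with respect to $\varrho$, let $f_n\in\mathcal P$ be its best approximation from $\mathcal P$ in the $L^2_\varrho(D)$-norm, let $0<\epsilon<1$, let $$m\ \ge\ 8\,\kappa_w\,\log(3n/\epsilon),$$ and let $x_1,\dots,x_m$ be i.i.d. random points with law $\mu$. Then, with probability at least $1-\epsilon$, the following holds for all $e=(e_i)_{i=1}^m\in\mathbb C^m$ simultaneously and for every minimizer $\hat f$ over $p\in\mathcal P$ of $$\frac1m\sum_{i=1}^m w(x_i)\,|f(x_i)+e_i-p(x_i)|^2 .$$ If $\mathcal R_2<\infty$, then $$\|f-\hat f\|_{L^2_\varrho(D)}\le\|f-f_n\|_{L^2_\varrho(D)}+\frac{8\,\mathcal R_2}{\sqrt\epsilon}\left(\|f-f_n\|_{L^2_\varrho(D)}+\|e\|_2\right),$$ and if $\mathcal R_\infty<\infty$, then $$\|f-\hat f\|_{L^\infty_\varrho(D)}\le\|f-f_n\|_{L^\infty_\varrho(D)}+\frac{8\,\mathcal R_\infty}{\sqrt\epsilon}\left(\|f-f_n\|_{L^2_\varrho(D)}+\|e\|_2\right),$$ where the right-hand side may be $+\infty$. -/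

import Mathlib

open MeasureTheory ProbabilityTheory
open scoped ENNReal

noncomputable section

namespace WLS

variable {D : Type*} [MeasurableSpace D]

/-- The weight function `w = 1 / v`, `v = dμ/dϱ`, with values in `[0, ∞]`. -/
def weight (μ ϱ : Measure D) (x : D) : ℝ≥0∞ := (μ.rnDeriv ϱ x)⁻¹

/-- The (reciprocal) Christoffel function of `P` in `L²_ν`:
`𝒦(x) = sup { |p(x)|² : p ∈ P, ‖p‖²_{L²_ν} = 1 }`. -/
def christoffel (P : Submodule ℂ (D → ℂ)) (ν : Measure D) (x : D) : ℝ≥0∞ :=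
  ⨆ p ∈ {p : D → ℂ | p ∈ P ∧ eLpNorm p 2 ν ^ 2 = 1}, ‖p x‖ₑ ^ 2

/-- `κ_w(P, L²_ν) = ess sup_{x ∼ ν} w(x) 𝒦(P, L²_ν)(x)`. -/
def kappa (w : D → ℝ≥0∞) (P : Submodule ℂ (D → ℂ)) (ν : Measure D) : ℝ≥0∞ :=
  essSup (fun x => w x * christoffel P ν x) ν

/-- The Remez constant
`sup { ‖p‖_{L^q_ϱ(D)} : p ∈ P, 0 < ‖p‖_{L^r_ϱ(Ω)} ≤ 1 }`, with values in `[0, ∞]`. -/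
def remez (P : Submodule ℂ (D → ℂ)) (ϱ : Measure D) (Ω : Set D) (q r : ℝ≥0∞) : ℝ≥0∞ :=
  ⨆ p ∈ {p : D → ℂ | p ∈ P ∧ 0 < eLpNorm p r (ϱ.restrict Ω) ∧
    eLpNorm p r (ϱ.restrict Ω) ≤ 1}, eLpNorm p q ϱ

/-- `g` is a best approximation to `f` from `P` in the `L²_ϱ(D)`-norm. -/
def IsBestApprox (P : Submodule ℂ (D → ℂ)) (ϱ : Measure D) (f g : D → ℂ) : Prop :=
  g ∈ P ∧ ∀ p ∈ P, eLpNorm (f - g) 2 ϱ ≤ eLpNorm (f - p) 2 ϱ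

/-- The weighted least-squares objective `(1/m) ∑ᵢ w(xᵢ) |yᵢ - p(xᵢ)|²`. -/
def objective {m : ℕ} (w : D → ℝ≥0∞) (x : Fin m → D) (y : Fin m → ℂ) (p : D → ℂ) : ℝ≥0∞ :=
  (m : ℝ≥0∞)⁻¹ * ∑ i, w (x i) * ‖y i - p (x i)‖ₑ ^ 2

/-- `g` is a minimizer over `P` of the weighted least-squares objective. -/
def IsMinimizer {m : ℕ} (P : Submodule ℂ (D → ℂ)) (w : D → ℝ≥0∞) (x : Fin m → D)
    (y : Fin m → ℂ) (g : D → ℂ) : Prop :=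
  g ∈ P ∧ ∀ p ∈ P, objective w x y g ≤ objective w x y p

end WLS

end

namespace WLS

open Matrix
open scoped ComplexOrder

/-! ### Traces of powers under a rank-one perturbation, and diagonalization. -/

section TracePotential

variable {ι : Type*} [Fintype ι]

/-! Write `A = ‖f - fn‖` in `L²(D)` and `X = ‖fhat - fn‖` in `L²(Ω)`. Three events, each failing
with probability at most `ε / 3`, suffice. (1) The sampled form dominates the norm over `Ω`: `∑
w(xᵢ)|p(xᵢ)|² ≥ (3/16) m ‖p‖²` for all `p ∈ P`. (2) `∑ w(xᵢ)|(f - fn)(xᵢ)|² ≤ (3/ε) m A²`. (3) `∑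
w(xᵢ) ≤ (3/ε) m`. The last two are Markov's inequality. Minimality of `fhat` and the triangle
inequality then give `√(3m/16) X ≤ 2 √(3m/ε) (A + ‖e‖)`, that is `X ≤ (8/√ε)(A + ‖e‖)`, and the
Remez constant carries this from `Ω` to `D`.

Event (1) is a lower-tail matrix Chernoff bound (`measure_exists_sum_inner_lt_le`) for the sampling
vectors `√w 1_Ω (φ̄ⱼ)ⱼ`, which are isotropic and have squared norm at most `κ_w`. Its proof follows
the potential `tr A⁻ᵖ` of `A = c + ∑ vᵢvᵢ*`. A rank-one update lowers it by at least `(p/2) v*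
A^{-(p+1)} v` (`tracePotential_add_vecMulVec_le`), so isotropy gives a mean drop of at least `(p/2)
tr A^{-(p+1)}`. Inductively `E tr A⁻ᵖ ≤ r (c + m/2)⁻ᵖ`, and a small eigenvalue makes the potential
large, so Markov applies again. -/

lemma dotProduct_vecMulVec_mulVec (u v w z : ι → ℂ) :
    u ⬝ᵥ (vecMulVec v w *ᵥ z) = (u ⬝ᵥ v) * (w ⬝ᵥ z) := by
  rw [vecMulVec_mulVec]
  simp [dotProduct_smul, mul_comm]

variable [DecidableEq ι]

lemma re_dotProduct_pow_nonneg {H : Matrix ι ι ℂ} (hH : H.PosSemidef) (y : ι → ℂ) (b : ℕ) :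
    0 ≤ (star y ⬝ᵥ (H ^ b *ᵥ y)).re :=
  (hH.pow b).re_dotProduct_nonneg y

/-- Exchanging the first factor `H` for `G` leaves a rank-one term, whose quadratic form at `y`
factors. -/
lemma re_mixed_succ {G H : Matrix ι ι ℂ} {y : ι → ℂ} {δ : ℝ} {g : ℕ → ℝ}
    (hH : H = G - (δ : ℂ) • vecMulVec y (star y))
    (hg : ∀ k, star y ⬝ᵥ (G ^ k *ᵥ y) = g k) (a b : ℕ) :
    (star y ⬝ᵥ ((G ^ a * H ^ (b + 1)) *ᵥ y)).re =
      (star y ⬝ᵥ ((G ^ (a + 1) * H ^ b) *ᵥ y)).re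
        - δ * (g a * (star y ⬝ᵥ (H ^ b *ᵥ y)).re) := by
  have h1 : G ^ a * H ^ (b + 1) =
      G ^ (a + 1) * H ^ b - (δ : ℂ) • (G ^ a * vecMulVec y (star y) * H ^ b) := by
    rw [pow_succ' H, ← mul_assoc]
    nth_rewrite 1 [hH]
    rw [mul_sub, sub_mul, pow_succ, mul_smul_comm, smul_mul_assoc]
  have h2 : star y ⬝ᵥ ((G ^ a * vecMulVec y (star y) * H ^ b) *ᵥ y) =
      g a * (star y ⬝ᵥ (H ^ b *ᵥ y)) := by
    rw [mul_assoc, ← mulVec_mulVec, ← mulVec_mulVec, vecMulVec_mulVec, ← hg]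
    simp [mulVec_smul, dotProduct_smul, mul_comm]
  rw [h1, sub_mulVec, smul_mulVec, dotProduct_sub, dotProduct_smul, h2]
  simp

/-- Each exchange of an `H` for a `G` costs between `0` and `ρ * g (a + b + 1)`. The upper bound at
`a = 0` is what controls the cost in the next step, so both bounds are carried through the
induction. -/
lemma re_mixed_bounds {G H : Matrix ι ι ℂ} {y : ι → ℂ} {δ ρ : ℝ} {g : ℕ → ℝ} (hδ : 0 ≤ δ)
    (hH : H = G - (δ : ℂ) • vecMulVec y (star y)) (hHpos : H.PosSemidef)
    (hg : ∀ k, star y ⬝ᵥ (G ^ k *ᵥ y) = g k) (hg0 : ∀ k, 0 ≤ g k)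
    (hgg : ∀ a b, δ * (g a * g b) ≤ ρ * g (a + b + 1)) (b : ℕ) : ∀ a : ℕ,
    (star y ⬝ᵥ ((G ^ a * H ^ b) *ᵥ y)).re ≤ g (a + b) ∧
      (1 - b * ρ) * g (a + b) ≤ (star y ⬝ᵥ ((G ^ a * H ^ b) *ᵥ y)).re := by
  induction b with
  | zero => intro a; simp [hg]
  | succ b ih =>
    intro a
    have h0 := re_dotProduct_pow_nonneg hHpos y b
    have h1 : (star y ⬝ᵥ (H ^ b *ᵥ y)).re ≤ g b := by simpa using (ih 0).1
    have h2 := ih (a + 1)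
    have h3 : δ * (g a * (star y ⬝ᵥ (H ^ b *ᵥ y)).re) ≤ δ * (g a * g b) := by
      have := hg0 a
      gcongr
    have h4 : 0 ≤ δ * (g a * (star y ⬝ᵥ (H ^ b *ᵥ y)).re) :=
      mul_nonneg hδ (mul_nonneg (hg0 a) h0)
    have h5 := hgg a b
    rw [re_mixed_succ hH hg]
    rw [show a + 1 + b = a + (b + 1) by ring] at h2
    rw [show a + b + 1 = a + (b + 1) by ring] at h5
    push_cast
    constructor <;> linarith [h2.1, h2.2]

/-- Telescoping along `H ^ b * G ^ (p - b)`; cyclicity of the trace turns each rank-one difference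
into a quadratic form. -/
lemma trace_pow_sub_trace_pow {G H : Matrix ι ι ℂ} {y : ι → ℂ} {δ : ℝ}
    (hH : H = G - (δ : ℂ) • vecMulVec y (star y)) (p : ℕ) :
    (G ^ p).trace - (H ^ p).trace =
      δ * ∑ b ∈ Finset.range p, star y ⬝ᵥ ((G ^ (p - 1 - b) * H ^ b) *ᵥ y) := by
  have key : ∀ b ∈ Finset.range p, (H ^ b * G ^ (p - b)).trace
      - (H ^ (b + 1) * G ^ (p - (b + 1))).trace =
      δ * (star y ⬝ᵥ ((G ^ (p - 1 - b) * H ^ b) *ᵥ y)) := by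
    intro b hb
    have hb' := Finset.mem_range.1 hb
    have e1 : p - b = (p - 1 - b) + 1 := by omega
    have e2 : p - (b + 1) = p - 1 - b := by omega
    rw [e2, e1, ← trace_sub, pow_succ H, pow_succ' G, mul_assoc, ← mul_sub, ← sub_mul]
    have : G - H = (δ : ℂ) • vecMulVec y (star y) := by rw [hH]; abel
    rw [this, smul_mul_assoc, mul_smul_comm, trace_smul, smul_eq_mul, vecMulVec_mul,
      mul_vecMulVec, trace_vecMulVec, dotProduct_comm, ← dotProduct_mulVec, mulVec_mulVec]
  rw [Finset.mul_sum, ← Finset.sum_congr rfl key,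
    Finset.sum_range_sub' (fun b => (H ^ b * G ^ (p - b)).trace)]
  simp

lemma trace_pow_drop {G H : Matrix ι ι ℂ} {y : ι → ℂ} {δ ρ : ℝ} {g : ℕ → ℝ} (hδ : 0 ≤ δ)
    (hH : H = G - (δ : ℂ) • vecMulVec y (star y)) (hHpos : H.PosSemidef)
    (hg : ∀ k, star y ⬝ᵥ (G ^ k *ᵥ y) = g k) (hg0 : ∀ k, 0 ≤ g k)
    (hgg : ∀ a b, δ * (g a * g b) ≤ ρ * g (a + b + 1)) (p : ℕ) :
    δ * ((p - ρ * (p * (p - 1) / 2)) * g (p - 1)) ≤ (G ^ p).trace.re - (H ^ p).trace.re := by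
  have h := congrArg Complex.re (trace_pow_sub_trace_pow hH p)
  rw [Complex.sub_re, Complex.re_ofReal_mul, Complex.re_sum] at h
  rw [h]
  refine mul_le_mul_of_nonneg_left ?_ hδ
  have h1 : ∀ b ∈ Finset.range p, (1 - b * ρ) * g (p - 1) ≤
      (star y ⬝ᵥ ((G ^ (p - 1 - b) * H ^ b) *ᵥ y)).re := by
    intro b hb
    have hb' := Finset.mem_range.1 hb
    have := (re_mixed_bounds hδ hH hHpos hg hg0 hgg b (p - 1 - b)).2
    rwa [show p - 1 - b + b = p - 1 by omega] at this
  refine le_trans (le_of_eq ?_) (Finset.sum_le_sum h1)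
  rw [← Finset.sum_mul]
  congr 1
  rw [Finset.sum_sub_distrib, ← Finset.sum_mul]
  have h2 : ∀ q : ℕ, ∑ b ∈ Finset.range q, (b : ℝ) = q * (q - 1) / 2 := by
    intro q
    induction q with
    | zero => simp
    | succ q ih => rw [Finset.sum_range_succ, ih]; push_cast; ring
  rw [h2]
  simp
  ring

/-- Chebyshev's inequality for the moments of a nonnegative weight. -/
lemma moment_mul_moment_le {ι : Type*} [Fintype ι] (l w : ι → ℝ) (hl : ∀ i, 0 ≤ l i)
    (hw : ∀ i, 0 ≤ w i) (a b : ℕ) :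
    (∑ i, l i ^ (a + 1) * w i) * (∑ i, l i ^ (b + 1) * w i) ≤
      (∑ i, l i ^ 1 * w i) * (∑ i, l i ^ (a + b + 1) * w i) := by
  -- Symmetrization: `s ↦ s ^ a` and `s ↦ s ^ b` are both increasing, so the two differences have
  -- the same sign.
  have h : 0 ≤ ∑ i, ∑ j, (l i * w i) * (l j * w j) * ((l i ^ a - l j ^ a) * (l i ^ b - l j ^ b)) := by
    refine Finset.sum_nonneg fun i _ => Finset.sum_nonneg fun j _ => ?_
    refine mul_nonneg (mul_nonneg (mul_nonneg (hl i) (hw i)) (mul_nonneg (hl j) (hw j))) ?_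
    rcases le_total (l i) (l j) with h | h
    · exact mul_nonneg_of_nonpos_of_nonpos
        (sub_nonpos.2 (pow_le_pow_left₀ (hl i) h a)) (sub_nonpos.2 (pow_le_pow_left₀ (hl i) h b))
    · exact mul_nonneg
        (sub_nonneg.2 (pow_le_pow_left₀ (hl j) h a)) (sub_nonneg.2 (pow_le_pow_left₀ (hl j) h b))
  have e : ∑ i, ∑ j, (l i * w i) * (l j * w j) * ((l i ^ a - l j ^ a) * (l i ^ b - l j ^ b)) =
      (∑ i, l i ^ (a + b + 1) * w i) * (∑ j, l j ^ 1 * w j)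
      - (∑ i, l i ^ (a + 1) * w i) * (∑ j, l j ^ (b + 1) * w j)
      - (∑ i, l i ^ (b + 1) * w i) * (∑ j, l j ^ (a + 1) * w j)
      + (∑ i, l i ^ 1 * w i) * (∑ j, l j ^ (a + b + 1) * w j) := by
    simp_rw [Finset.sum_mul_sum, ← Finset.sum_sub_distrib, ← Finset.sum_add_distrib]
    refine Finset.sum_congr rfl fun i _ => Finset.sum_congr rfl fun j _ => ?_
    ring
  rw [e] at h
  nlinarith [h]

/-- `A = U diag(α) U*` with `U` unitary. -/
structure IsDiagonalization (A U : Matrix ι ι ℂ) (α : ι → ℝ) : Prop where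
  left : star U * U = 1
  right : U * star U = 1
  eq : A = U * diagonal (fun i => (α i : ℂ)) * star U

lemma _root_.Matrix.IsHermitian.exists_isDiagonalization {A : Matrix ι ι ℂ}
    (hA : A.IsHermitian) : ∃ U α, IsDiagonalization A U α := by
  refine ⟨hA.eigenvectorUnitary, hA.eigenvalues, ?_, ?_, ?_⟩
  · simp
  · simp
  · conv_lhs => rw [hA.spectral_theorem]
    rfl

namespace IsDiagonalization

variable {A U : Matrix ι ι ℂ} {α : ι → ℝ}

lemma pow (h : IsDiagonalization A U α) (k : ℕ) : IsDiagonalization (A ^ k) U (fun i => α i ^ k) := by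
  refine ⟨h.left, h.right, ?_⟩
  induction k with
  | zero => simp [h.right]
  | succ k ih =>
    rw [pow_succ, ih]
    conv_lhs => rw [h.eq]
    calc U * diagonal (fun i => ((α i ^ k : ℝ) : ℂ)) * star U * (U * diagonal (fun i => (α i : ℂ)) * star U)
        = U * diagonal (fun i => ((α i ^ k : ℝ) : ℂ)) * (star U * U) * diagonal (fun i => (α i : ℂ)) * star U := by
          simp only [mul_assoc]
      _ = _ := by
          rw [h.left, mul_one, mul_assoc U, diagonal_mul_diagonal]
          congr 3
          ext i; push_cast; rw [pow_succ]

lemma mul_inv_eq_one (h : IsDiagonalization A U α) (hα : ∀ i, α i ≠ 0) :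
    A * (U * diagonal (fun i => (((α i)⁻¹ : ℝ) : ℂ)) * star U) = 1 := by
  conv_lhs => rw [h.eq]
  calc U * diagonal (fun i => (α i : ℂ)) * star U *
        (U * diagonal (fun i => (((α i)⁻¹ : ℝ) : ℂ)) * star U)
      = U * diagonal (fun i => (α i : ℂ)) * (star U * U) *
          diagonal (fun i => (((α i)⁻¹ : ℝ) : ℂ)) * star U := by
        simp only [mul_assoc]
    _ = 1 := by
        rw [h.left, mul_one, mul_assoc U, diagonal_mul_diagonal]
        have : (fun i => (α i : ℂ) * (((α i)⁻¹ : ℝ) : ℂ)) = fun _ => 1 := by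
          ext i; push_cast; exact mul_inv_cancel₀ (by exact_mod_cast hα i)
        rw [this, diagonal_one, mul_one, h.right]

lemma inv (h : IsDiagonalization A U α) (hα : ∀ i, α i ≠ 0) :
    IsDiagonalization A⁻¹ U (fun i => (α i)⁻¹) :=
  ⟨h.left, h.right, inv_eq_right_inv (h.mul_inv_eq_one hα)⟩

lemma trace (h : IsDiagonalization A U α) : A.trace = ((∑ i, α i : ℝ) : ℂ) := by
  rw [h.eq, trace_mul_comm, ← mul_assoc, h.left, one_mul, trace_diagonal]
  push_cast; rfl

lemma quadForm (h : IsDiagonalization A U α) (x : ι → ℂ) :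
    star x ⬝ᵥ (A *ᵥ x) = ((∑ i, α i * ‖(star U *ᵥ x) i‖ ^ 2 : ℝ) : ℂ) := by
  rw [h.eq, ← mulVec_mulVec, ← mulVec_mulVec, dotProduct_mulVec]
  have : star x ᵥ* U = star (star U *ᵥ x) := by
    rw [star_mulVec]; simp [star_eq_conjTranspose]
  rw [this]
  simp only [dotProduct, mulVec_diagonal, Pi.star_apply]
  push_cast
  refine Finset.sum_congr rfl fun i _ => ?_
  rw [← Complex.conj_mul']
  simp; ring

lemma sum_sq (h : IsDiagonalization A U α) (x : ι → ℂ) :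
    ∑ i, ‖(star U *ᵥ x) i‖ ^ 2 = ∑ i, ‖x i‖ ^ 2 := by
  have h1 : IsDiagonalization (1 : Matrix ι ι ℂ) U (fun _ => 1) := ⟨h.left, h.right, by simp [h.right]⟩
  have h2 := h1.quadForm x
  have h3 : star x ⬝ᵥ x = ((∑ i, ‖x i‖ ^ 2 : ℝ) : ℂ) := by
    simp only [dotProduct, Pi.star_apply]
    push_cast
    refine Finset.sum_congr rfl fun i _ => ?_
    rw [← Complex.conj_mul']; rfl
  rw [one_mulVec, h3] at h2
  simpa using (Complex.ofReal_injective h2).symm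

/-- Test the shifted form on the `i`-th column of `U`. -/
lemma le_of_posSemidef (h : IsDiagonalization A U α) {c : ℝ}
    (hc : (A - (c : ℂ) • (1 : Matrix ι ι ℂ)).PosSemidef) (i : ι) : c ≤ α i := by
  have h1 : IsDiagonalization (A - (c : ℂ) • (1 : Matrix ι ι ℂ)) U (fun i => α i - c) := by
    refine ⟨h.left, h.right, ?_⟩
    have : diagonal (fun i => ((α i - c : ℝ) : ℂ)) =
        diagonal (fun i => (α i : ℂ)) - (c : ℂ) • (1 : Matrix ι ι ℂ) := by
      ext a b; by_cases hab : a = b <;> simp [hab, diagonal]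
    rw [this, mul_sub, sub_mul, ← h.eq]
    simp [h.right]
  have h2 := hc.re_dotProduct_nonneg (U *ᵥ Pi.single i 1)
  rw [h1.quadForm, mulVec_mulVec, h.left, one_mulVec] at h2
  have h3 : ∑ j, (α j - c) * ‖(Pi.single i 1 : ι → ℂ) j‖ ^ 2 = α i - c := by
    rw [Finset.sum_eq_single i]
    · simp
    · intro b _ hb; simp [hb]
    · simp
  rw [h3] at h2
  simpa using h2

end IsDiagonalization

end TracePotential

lemma posSemidef_of_sub {ι : Type*} [DecidableEq ι] {A : Matrix ι ι ℂ} {c : ℝ} (hc : 0 ≤ c)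
    (hA : (A - (c : ℂ) • (1 : Matrix ι ι ℂ)).PosSemidef) : A.PosSemidef := by
  have h1 : ((c : ℂ) • (1 : Matrix ι ι ℂ)).PosSemidef :=
    PosSemidef.one.smul (by exact_mod_cast hc)
  simpa using hA.add h1

/-! ### The potential under one random rank-one update. -/

section Potential

variable {ι : Type*} [Fintype ι] [DecidableEq ι]

/-- The potential `tr A⁻ᵖ`. -/
noncomputable def tracePotential (p : ℕ) (A : Matrix ι ι ℂ) : ℝ := ((A⁻¹) ^ p).trace.re

lemma exists_isDiagonalization_ge {A : Matrix ι ι ℂ} {c : ℝ}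
    (hA : (A - (c : ℂ) • (1 : Matrix ι ι ℂ)).PosSemidef) :
    ∃ U α, IsDiagonalization A U α ∧ ∀ i, c ≤ α i := by
  have h1 : A.IsHermitian := by
    have h2 : ((c : ℂ) • (1 : Matrix ι ι ℂ)).IsHermitian := by
      ext i j
      by_cases h : i = j
      · simp [h]
      · simp [h, Ne.symm h]
    simpa using hA.isHermitian.add h2
  obtain ⟨U, α, h⟩ := h1.exists_isDiagonalization
  exact ⟨U, α, h, h.le_of_posSemidef hA⟩

lemma IsDiagonalization.tracePotential {A U : Matrix ι ι ℂ} {α : ι → ℝ}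
    (h : IsDiagonalization A U α) (hα : ∀ i, α i ≠ 0) (p : ℕ) :
    tracePotential p A = ∑ i, ((α i)⁻¹) ^ p := by
  rw [WLS.tracePotential, ((h.inv hα).pow p).trace, Complex.ofReal_re]

lemma posSemidef_add_vecMulVec_sub {A : Matrix ι ι ℂ} {c : ℝ}
    (hA : (A - (c : ℂ) • (1 : Matrix ι ι ℂ)).PosSemidef) (x : ι → ℂ) :
    (A + vecMulVec x (star x) - (c : ℂ) • (1 : Matrix ι ι ℂ)).PosSemidef := by
  have := hA.add (posSemidef_vecMulVec_self_star x)
  rwa [sub_add_eq_add_sub] at this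

/-- A rank-one update decreases the potential `tr A⁻ᵖ`. -/
lemma tracePotential_add_vecMulVec_le {A U : Matrix ι ι ℂ} {α : ι → ℝ} {c : ℝ} (hc : 0 < c)
    (hA : (A - (c : ℂ) • (1 : Matrix ι ι ℂ)).PosSemidef) (h : IsDiagonalization A U α)
    (hα : ∀ i, c ≤ α i) {p : ℕ} (hp : 1 ≤ p) (x : ι → ℂ) (hx : 2 * p * ∑ i, ‖x i‖ ^ 2 ≤ c) :
    tracePotential p (A + vecMulVec x (star x)) +
      p / 2 * ∑ i, ((α i)⁻¹) ^ (p + 1) * ‖(star U *ᵥ x) i‖ ^ 2 ≤ tracePotential p A := by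
  have hα0 : ∀ i, 0 < α i := fun i => hc.trans_le (hα i)
  have hG := h.inv (fun i => (hα0 i).ne')
  set G := A⁻¹
  set w : ι → ℝ := fun i => ‖(star U *ᵥ x) i‖ ^ 2 with hw
  set l : ι → ℝ := fun i => (α i)⁻¹ with hl
  have hl0 : ∀ i, 0 ≤ l i := fun i => (inv_pos.2 (hα0 i)).le
  have hw0 : ∀ i, 0 ≤ w i := fun i => by positivity
  have hq : ∀ k, star x ⬝ᵥ (G ^ k *ᵥ x) = ((∑ i, l i ^ k * w i : ℝ) : ℂ) :=
    fun k => (hG.pow k).quadForm x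
  set q : ℕ → ℝ := fun k => ∑ i, l i ^ k * w i with hqdef
  have hq0 : ∀ k, 0 ≤ q k :=
    fun k => Finset.sum_nonneg fun i _ => mul_nonneg (pow_nonneg (hl0 i) k) (hw0 i)
  have hAG : A * G = 1 := by
    rw [hG.eq]
    exact h.mul_inv_eq_one (fun i => (hα0 i).ne')
  have hGH : G.IsHermitian := (posSemidef_of_sub hc.le hA).isHermitian.inv
  set y := G *ᵥ x with hy
  have hsy : star y = star x ᵥ* G := by
    rw [hy, star_mulVec, hGH.eq]
  set δ : ℝ := (1 + q 1)⁻¹ with hδ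
  have hδ0 : 0 < δ := by have := hq0 1; positivity
  have hδ1 : δ * (1 + q 1) = 1 := inv_mul_cancel₀ (by have := hq0 1; positivity)
  have hAy : A *ᵥ y = x := by rw [hy, mulVec_mulVec, hAG, one_mulVec]
  have hxy : star x ⬝ᵥ y = (q 1 : ℂ) := by
    have := hq 1
    rwa [pow_one] at this
  -- The Sherman–Morrison formula, with `y = A⁻¹ x` and `q 1 = x* A⁻¹ x`.
  have hH : (A + vecMulVec x (star x))⁻¹ = G - (δ : ℂ) • vecMulVec y (star y) := by
    refine inv_eq_right_inv ?_
    rw [add_mul, mul_sub, mul_sub, hAG, mul_smul_comm, mul_smul_comm, mul_vecMulVec, hAy,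
      vecMulVec_mul_vecMulVec, hxy, vecMulVec_mul, ← hsy]
    have : (δ : ℂ) * (1 + q 1) = 1 := by exact_mod_cast hδ1
    have e : vecMulVec x (star y) = (δ : ℂ) • vecMulVec x (star y) +
        (δ : ℂ) • vecMulVec x ((q 1 : ℂ) • star y) := by
      rw [vecMulVec_smul, smul_smul, ← add_smul]
      rw [show (δ : ℂ) + δ * q 1 = 1 by rw [← this]; ring, one_smul]
    conv_lhs => enter [2, 1]; rw [e]
    abel
  have hHpos : (A + vecMulVec x (star x))⁻¹.PosSemidef :=
    (posSemidef_of_sub hc.le (posSemidef_add_vecMulVec_sub hA x)).inv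
  -- The shift by `2` comes from the two copies of `G` in `y = G x`.
  have hg : ∀ k, star y ⬝ᵥ (G ^ k *ᵥ y) = (q (k + 2) : ℝ) := by
    intro k
    rw [← hq, hsy, ← dotProduct_mulVec, hy, mulVec_mulVec, mulVec_mulVec, pow_succ, pow_succ']
  have hq1 : 2 * p * q 1 ≤ 1 := by
    have h1 : q 1 ≤ c⁻¹ * ∑ i, w i := by
      rw [Finset.mul_sum]
      refine Finset.sum_le_sum fun i _ => mul_le_mul_of_nonneg_right ?_ (hw0 i)
      rw [pow_one]
      exact inv_anti₀ hc (hα i)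
    have h2 : ∑ i, w i = ∑ i, ‖x i‖ ^ 2 := h.sum_sq x
    rw [h2] at h1
    calc 2 * p * q 1 ≤ 2 * p * (c⁻¹ * ∑ i, ‖x i‖ ^ 2) := by gcongr
      _ = c⁻¹ * (2 * p * ∑ i, ‖x i‖ ^ 2) := by ring
      _ ≤ c⁻¹ * c := by gcongr
      _ = 1 := inv_mul_cancel₀ hc.ne'
  have hdrop := trace_pow_drop (G := G) (ρ := δ * q 1) (g := fun k => q (k + 2)) hδ0.le hH hHpos hg
    (fun k => hq0 _) (fun a b => by
      have h1 := moment_mul_moment_le l w hl0 hw0 (a + 1) (b + 1)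
      have h2 : q (a + 2) * q (b + 2) ≤ q 1 * q (a + b + 1 + 2) := by
        convert h1 using 3
        ring_nf
      calc δ * (q (a + 2) * q (b + 2)) ≤ δ * (q 1 * q (a + b + 1 + 2)) := by gcongr
        _ = _ := by ring) p
  have hp1 : p - 1 + 2 = p + 1 := by omega
  rw [hp1] at hdrop
  have hpR : (1 : ℝ) ≤ p := by exact_mod_cast hp
  -- Since `2 * p * q 1 ≤ 1`, the second-order loss is at most `(p - 1) / 4`, and the factor `1 / δ
  -- = 1 + q 1` raises `p / 2` by at most `1 / 4`.
  have hfac : (p : ℝ) / 2 ≤ δ * (p - δ * q 1 * (p * (p - 1) / 2)) := by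
    have hδle : δ ≤ 1 := inv_le_one_of_one_le₀ (by linarith [hq0 1])
    have h3 : δ * q 1 * (p * (p - 1) / 2) ≤ (p - 1) / 4 := by
      calc δ * q 1 * (p * (p - 1) / 2) = δ * (2 * p * q 1) * ((p - 1) / 4) := by ring
        _ ≤ 1 * 1 * ((p - 1) / 4) := by
          have : 0 ≤ 2 * p * q 1 := by have := hq0 1; positivity
          gcongr
        _ = _ := by ring
    have h4 : δ * (p - (p - 1) / 4) ≤ δ * (p - δ * q 1 * (p * (p - 1) / 2)) := by
      gcongr
    refine le_trans ?_ h4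
    have h5 : (p : ℝ) / 2 * (1 + q 1) ≤ p - (p - 1) / 4 := by nlinarith
    calc (p : ℝ) / 2 = δ * ((p : ℝ) / 2 * (1 + q 1)) := by
          rw [mul_comm (p / 2 : ℝ), ← mul_assoc, hδ1, one_mul]
      _ ≤ _ := by gcongr
  have h6 : (p : ℝ) / 2 * q (p + 1) ≤
      δ * (p - δ * q 1 * (p * (p - 1) / 2)) * q (p + 1) :=
    mul_le_mul_of_nonneg_right hfac (hq0 _)
  unfold tracePotential
  have h7 : δ * ((p - δ * q 1 * (p * (p - 1) / 2)) * q (p + 1)) ≤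
    (G ^ p).trace.re - ((A + vecMulVec x (star x))⁻¹ ^ p).trace.re := hdrop
  have h8 : (p : ℝ) / 2 * ∑ i, (α i)⁻¹ ^ (p + 1) * ‖(star U *ᵥ x) i‖ ^ 2 = p / 2 * q (p + 1) := rfl
  rw [h8]
  linarith

/-- Bernoulli's inequality for `(t / l) ^ (p + 1)`. It is the tangent at `l = t` to `l ^ (p + 1)` as
a convex function of `l ^ p`. -/
lemma tangent_pow_le {l t : ℝ} (hl : 0 < l) (ht : 0 < t) (p : ℕ) :
    (p + 1) * t * l ^ p - t ^ (p + 1) ≤ p * l ^ (p + 1) := by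
  have h := one_add_mul_le_pow (a := t / l - 1) (by have := div_pos ht hl; linarith) (p + 1)
  have h2 : (1 + ((p + 1 : ℕ) : ℝ) * (t / l - 1)) * l ^ (p + 1) ≤ (1 + (t / l - 1)) ^ (p + 1) * l ^ (p + 1) :=
    mul_le_mul_of_nonneg_right h (by positivity)
  rw [← mul_pow, show (1 + (t / l - 1)) * l = t by field_simp; ring] at h2
  have h3 : (1 + ((p + 1 : ℕ) : ℝ) * (t / l - 1)) * l ^ (p + 1) =
      (p + 1) * t * l ^ p - p * l ^ (p + 1) := by
    push_cast; field_simp; ring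
  linarith

/-- The columns of `U` are unit vectors, so isotropy makes the integral of the guaranteed drop
`(p/2) tr A^{-(p+1)}`. The tangent inequality replaces this by an affine function of `tr A⁻ᵖ`, which
lets the recursion close in the mean potential alone. -/
lemma lintegral_tracePotential_le {ν : Measure (EuclideanSpace ℂ ι)} [IsProbabilityMeasure ν]
    {κ c : ℝ} {p : ℕ} (hp : 1 ≤ p) (hc : 0 < c) (hκ : 2 * p * κ ≤ c)
    (hbound : ∀ᵐ v ∂ν, ‖v‖ ^ 2 ≤ κ) (hiso : ∀ a, ∫⁻ v, ‖inner ℂ a v‖ₑ ^ 2 ∂ν = ‖a‖ₑ ^ 2)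
    {A : Matrix ι ι ℂ} (hA : (A - (c : ℂ) • (1 : Matrix ι ι ℂ)).PosSemidef) {t : ℝ} (ht : 0 < t) :
    ∫⁻ v, ENNReal.ofReal (tracePotential p (A + vecMulVec v.ofLp (star v.ofLp))) ∂ν ≤
      ENNReal.ofReal ((1 - (p + 1) * t / 2) * tracePotential p A +
        Fintype.card ι / 2 * t ^ (p + 1)) := by
  obtain ⟨U, α, h, hα⟩ := exists_isDiagonalization_ge hA
  have hα0 : ∀ i, 0 < α i := fun i => hc.trans_le (hα i)
  set Q : EuclideanSpace ℂ ι → ℝ≥0∞ := fun v =>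
    ∑ i, ENNReal.ofReal (p / 2 * (α i)⁻¹ ^ (p + 1)) * ‖(star U *ᵥ v.ofLp) i‖ₑ ^ 2 with hQ
  have hinner : ∀ i (v : EuclideanSpace ℂ ι),
      (star U *ᵥ v.ofLp) i = inner ℂ (WithLp.toLp 2 (fun j => U j i)) v := by
    intro i v
    simp [PiLp.inner_apply, mulVec, dotProduct, mul_comm]
  have hcol : ∀ i, ‖(WithLp.toLp 2 (fun j => U j i) : EuclideanSpace ℂ ι)‖ₑ ^ 2 = 1 := by
    intro i
    have h1 : ‖(WithLp.toLp 2 (fun j => U j i) : EuclideanSpace ℂ ι)‖ ^ 2 = 1 := by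
      have h2 := h.sum_sq (U *ᵥ Pi.single i 1)
      rw [mulVec_mulVec, h.left, one_mulVec] at h2
      rw [EuclideanSpace.norm_sq_eq]
      simp only [mulVec_single_one] at h2
      have h3 : ∑ j, ‖(Pi.single i 1 : ι → ℂ) j‖ ^ 2 = 1 := by
        rw [Finset.sum_eq_single i]
        · simp
        · intro b _ hb; simp [hb]
        · simp
      rw [h3] at h2
      exact h2.symm
    rw [← ofReal_norm, ← ENNReal.ofReal_pow (norm_nonneg _), h1, ENNReal.ofReal_one]
  have hQint : ∫⁻ v, Q v ∂ν = ENNReal.ofReal (p / 2 * ∑ i, (α i)⁻¹ ^ (p + 1)) := by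
    rw [hQ, lintegral_finsetSum]
    · rw [Finset.mul_sum, ENNReal.ofReal_sum_of_nonneg]
      · refine Finset.sum_congr rfl fun i _ => ?_
        rw [lintegral_const_mul' _ _ ENNReal.ofReal_ne_top]
        simp_rw [hinner]
        rw [hiso, hcol, mul_one]
      · intro i _
        have := hα0 i
        positivity
    · intro i _
      simp_rw [hinner]
      exact (Continuous.measurable (by fun_prop)).enorm.pow_const 2 |>.const_mul _
  have hQmeas : Measurable Q := by
    refine Finset.measurable_sum _ fun i _ => ?_
    simp_rw [hinner]
    exact (Continuous.measurable (by fun_prop)).enorm.pow_const 2 |>.const_mul _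
  have hVA := h.tracePotential (fun i => (hα0 i).ne') p
  have hstep : ∫⁻ v, ENNReal.ofReal (tracePotential p (A + vecMulVec v.ofLp (star v.ofLp))) ∂ν +
      ∫⁻ v, Q v ∂ν ≤ ENNReal.ofReal (tracePotential p A) := by
    rw [← lintegral_add_right _ hQmeas]
    calc ∫⁻ v, (ENNReal.ofReal (tracePotential p (A + vecMulVec v.ofLp (star v.ofLp))) + Q v) ∂ν
        ≤ ∫⁻ _, ENNReal.ofReal (tracePotential p A) ∂ν := by
          refine lintegral_mono_ae ?_
          filter_upwards [hbound] with v hv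
          have h1 := tracePotential_add_vecMulVec_le hc hA h hα hp v.ofLp (by
            rw [← EuclideanSpace.norm_sq_eq]
            refine le_trans ?_ hκ
            gcongr)
          have h2 : Q v = ENNReal.ofReal
              (p / 2 * ∑ i, ((α i)⁻¹) ^ (p + 1) * ‖(star U *ᵥ v.ofLp) i‖ ^ 2) := by
            rw [Finset.mul_sum, ENNReal.ofReal_sum_of_nonneg]
            · refine Finset.sum_congr rfl fun i _ => ?_
              have := hα0 i
              rw [← mul_assoc, ENNReal.ofReal_mul (q := ‖_‖ ^ 2) (by positivity),
                ENNReal.ofReal_pow (norm_nonneg _), ofReal_norm]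
            · intro i _
              have := hα0 i
              positivity
          have h3 : 0 ≤ tracePotential p (A + vecMulVec v.ofLp (star v.ofLp)) := by
            obtain ⟨U', α', h', hα'⟩ :=
              exists_isDiagonalization_ge (posSemidef_add_vecMulVec_sub hA v.ofLp)
            have hα0' : ∀ i, 0 < α' i := fun i => hc.trans_le (hα' i)
            rw [h'.tracePotential (fun i => (hα0' i).ne')]
            exact Finset.sum_nonneg fun i _ => pow_nonneg (inv_pos.2 (hα0' i)).le _
          rw [h2, ← ENNReal.ofReal_add h3]
          · exact ENNReal.ofReal_le_ofReal h1
          · refine mul_nonneg (by positivity) (Finset.sum_nonneg fun i _ => ?_)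
            have := hα0 i
            positivity
      _ = _ := by simp
  rw [hQint] at hstep
  have h4 := ENNReal.le_sub_of_add_le_right ENNReal.ofReal_ne_top hstep
  rw [← ENNReal.ofReal_sub _ (by
    refine mul_nonneg (by positivity) (Finset.sum_nonneg fun i _ => ?_)
    have := hα0 i
    positivity)] at h4
  refine h4.trans (ENNReal.ofReal_le_ofReal ?_)
  rw [hVA, Finset.mul_sum, Finset.mul_sum, ← Finset.sum_sub_distrib]
  have h5 : (Fintype.card ι : ℝ) / 2 * t ^ (p + 1) = ∑ _i : ι, t ^ (p + 1) / 2 := by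
    rw [Finset.sum_const, Finset.card_univ, nsmul_eq_mul]; ring
  rw [h5, ← Finset.sum_add_distrib]
  refine Finset.sum_le_sum fun i _ => ?_
  have := tangent_pow_le (inv_pos.2 (hα0 i)) ht p
  linarith

end Potential

/-! ### The lower-tail matrix Chernoff bound. -/

section Chernoff

variable {ι : Type*} [Fintype ι] [DecidableEq ι]

/-- The shifted Gram sum `c + ∑ vᵢ vᵢ*`. -/
noncomputable def shiftedGram (c : ℝ) {m : ℕ} (v : Fin m → EuclideanSpace ℂ ι) : Matrix ι ι ℂ :=
  (c : ℂ) • 1 + ∑ i, vecMulVec (v i).ofLp (star (v i).ofLp)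

lemma posSemidef_shiftedGram_sub (c : ℝ) {m : ℕ} (v : Fin m → EuclideanSpace ℂ ι) :
    (shiftedGram c v - (c : ℂ) • (1 : Matrix ι ι ℂ)).PosSemidef := by
  rw [shiftedGram, add_sub_cancel_left]
  exact posSemidef_sum _ fun i _ => posSemidef_vecMulVec_self_star _

lemma measurable_tracePotential_shiftedGram (p : ℕ) (c : ℝ) (m : ℕ) :
    Measurable fun v : Fin m → EuclideanSpace ℂ ι => tracePotential p (shiftedGram c v) := by
  have hcont : Continuous fun v : Fin m → EuclideanSpace ℂ ι => shiftedGram c v := by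
    unfold shiftedGram
    refine continuous_const.add (continuous_finsetSum _ fun i _ => ?_)
    refine Continuous.matrix_vecMulVec ?_ ?_
    · fun_prop
    · exact Continuous.star (by fun_prop)
  -- Determinant and adjugate are continuous in the matrix, so only a scalar inverse remains to be
  -- measured.
  have h : ∀ A : Matrix ι ι ℂ, tracePotential p A = ((A.det)⁻¹ ^ p * (A.adjugate ^ p).trace).re := by
    intro A
    rw [tracePotential, Matrix.inv_def, smul_pow, trace_smul, Ring.inverse_eq_inv', smul_eq_mul]
  simp_rw [h]
  refine Complex.measurable_re.comp (Measurable.mul ?_ ?_)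
  · exact (hcont.matrix_det.measurable.inv).pow_const p
  · exact (hcont.matrix_adjugate.pow p).matrix_trace.measurable

lemma quadForm_shiftedGram (c : ℝ) {m : ℕ} (v : Fin m → EuclideanSpace ℂ ι)
    (a : EuclideanSpace ℂ ι) :
    star a.ofLp ⬝ᵥ (shiftedGram c v *ᵥ a.ofLp) =
      ((c * ‖a‖ ^ 2 + ∑ i, ‖inner ℂ (v i) a‖ ^ 2 : ℝ) : ℂ) := by
  have h1 : star a.ofLp ⬝ᵥ a.ofLp = ((‖a‖ ^ 2 : ℝ) : ℂ) := by
    rw [EuclideanSpace.norm_sq_eq]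
    simp only [dotProduct, Pi.star_apply]
    push_cast
    refine Finset.sum_congr rfl fun i _ => ?_
    rw [← Complex.conj_mul']; rfl
  have h2 : ∀ i, star a.ofLp ⬝ᵥ (vecMulVec (v i).ofLp (star (v i).ofLp) *ᵥ a.ofLp) =
      ((‖inner ℂ (v i) a‖ ^ 2 : ℝ) : ℂ) := by
    intro i
    have e1 : star (v i).ofLp ⬝ᵥ a.ofLp = inner ℂ (v i) a := by
      simp [PiLp.inner_apply, dotProduct, mul_comm]
    have e2 : star a.ofLp ⬝ᵥ (v i).ofLp = (starRingEnd ℂ) (inner ℂ (v i) a) := by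
      rw [inner_conj_symm]
      simp [PiLp.inner_apply, dotProduct, mul_comm]
    rw [dotProduct_vecMulVec_mulVec, e1, e2, Complex.conj_mul']
    push_cast; rfl
  rw [shiftedGram, add_mulVec, dotProduct_add, smul_mulVec, one_mulVec, dotProduct_smul, h1,
    sum_mulVec, dotProduct_sum, Finset.sum_congr rfl fun i _ => h2 i]
  push_cast
  rfl

/-- Induction on `m`, integrating out the last vector. With `t` the inverse of the previous level `c
+ m / 2`, the one-step bound becomes the factor `1 - p t / 2`, and Bernoulli gives `1 - p t / 2 ≤ (1
+ t / 2)⁻ᵖ`, which raises the level by `1 / 2`. -/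
lemma lintegral_tracePotential_shiftedGram_le {ν : Measure (EuclideanSpace ℂ ι)}
    [IsProbabilityMeasure ν] {κ c : ℝ} {p : ℕ} (hp : 1 ≤ p) (hκ1 : 1 ≤ κ) (hκ : 2 * p * κ ≤ c)
    (hbound : ∀ᵐ v ∂ν, ‖v‖ ^ 2 ≤ κ) (hiso : ∀ a, ∫⁻ v, ‖inner ℂ a v‖ₑ ^ 2 ∂ν = ‖a‖ₑ ^ 2)
    (m : ℕ) :
    ∫⁻ v, ENNReal.ofReal (tracePotential p (shiftedGram c v)) ∂(Measure.pi fun _ : Fin m => ν) ≤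
      ENNReal.ofReal (Fintype.card ι * ((c + m / 2)⁻¹) ^ p) := by
  have hpR : (1 : ℝ) ≤ p := by exact_mod_cast hp
  have hc2 : 2 * (p : ℝ) ≤ c := le_trans (by nlinarith) hκ
  have hc : 0 < c := by linarith
  induction m with
  | zero =>
    have h1 : ∀ v : Fin 0 → EuclideanSpace ℂ ι,
        tracePotential p (shiftedGram c v) = Fintype.card ι * (c⁻¹) ^ p := by
      intro v
      have h2 : IsDiagonalization (shiftedGram c v) 1 (fun _ => c) := by
        refine ⟨by simp, by simp, ?_⟩
        simp [shiftedGram, smul_one_eq_diagonal]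
      rw [h2.tracePotential (fun _ => hc.ne')]
      simp
    simp_rw [h1]
    simp
  | succ m ih =>
    set t : ℝ := (c + m / 2)⁻¹ with ht
    have hcm : 0 < c + m / 2 := by positivity
    have ht0 : 0 < t := inv_pos.2 hcm
    -- The coefficient of the potential must be nonnegative for the induction hypothesis to be
    -- inserted.
    have htle : (p + 1) * t / 2 ≤ 1 := by
      rw [ht, ← div_eq_mul_inv, div_div, div_le_one (by positivity)]
      have : (0 : ℝ) ≤ m := by positivity
      nlinarith
    have hmp : MeasurePreserving (MeasurableEquiv.piFinSuccAbove
        (fun _ : Fin (m + 1) => EuclideanSpace ℂ ι) (Fin.last m)).symm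
        (ν.prod (Measure.pi fun _ : Fin m => ν)) (Measure.pi fun _ : Fin (m + 1) => ν) :=
      (measurePreserving_piFinSuccAbove (fun _ : Fin (m + 1) => ν) (Fin.last m)).symm
    have hσ : SigmaFinite (Measure.pi fun _ : Fin m => ν) := inferInstance
    have hs : SFinite (Measure.pi fun _ : Fin m => ν) := @instSFiniteOfSigmaFinite _ _ _ hσ
    have hfub := lintegral_prod_symm (μ := ν) (ν := Measure.pi fun _ : Fin m => ν)
      (fun z => ENNReal.ofReal (tracePotential p (shiftedGram c ((MeasurableEquiv.piFinSuccAbove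
        (fun _ : Fin (m + 1) => EuclideanSpace ℂ ι) (Fin.last m)).symm z))))
      ((measurable_tracePotential_shiftedGram p c (m + 1)).ennreal_ofReal.comp
        (MeasurableEquiv.measurable _)).aemeasurable
    rw [← hmp.lintegral_comp_emb (MeasurableEquiv.measurableEmbedding _)]
    refine (le_of_eq hfub).trans ?_
    · have hsplit : ∀ (v : Fin m → EuclideanSpace ℂ ι) (x : EuclideanSpace ℂ ι),
          shiftedGram c ((MeasurableEquiv.piFinSuccAbove (fun _ => EuclideanSpace ℂ ι)
            (Fin.last m)).symm (x, v)) = shiftedGram c v + vecMulVec x.ofLp (star x.ofLp) := by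
        intro v x
        rw [shiftedGram, shiftedGram, Fin.sum_univ_castSucc, add_assoc]
        simp [MeasurableEquiv.piFinSuccAbove, Fin.insertNthEquiv]
      simp_rw [hsplit]
      calc _ ≤ ∫⁻ v, ENNReal.ofReal ((1 - (p + 1) * t / 2) * tracePotential p (shiftedGram c v) +
              Fintype.card ι / 2 * t ^ (p + 1)) ∂(Measure.pi fun _ : Fin m => ν) :=
            lintegral_mono fun v => lintegral_tracePotential_le hp hc hκ hbound hiso
              (posSemidef_shiftedGram_sub c v) ht0
        _ ≤ ∫⁻ v, (ENNReal.ofReal (1 - (p + 1) * t / 2) *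
              ENNReal.ofReal (tracePotential p (shiftedGram c v)) +
              ENNReal.ofReal (Fintype.card ι / 2 * t ^ (p + 1)))
                ∂(Measure.pi fun _ : Fin m => ν) := by
            refine lintegral_mono fun v => ?_
            rw [← ENNReal.ofReal_mul (by linarith)]
            exact ENNReal.ofReal_add_le
        _ = ENNReal.ofReal (1 - (p + 1) * t / 2) *
              (∫⁻ v, ENNReal.ofReal (tracePotential p (shiftedGram c v))
                ∂(Measure.pi fun _ : Fin m => ν)) +
              ENNReal.ofReal (Fintype.card ι / 2 * t ^ (p + 1)) := by
            rw [lintegral_add_right _ measurable_const, lintegral_const_mul' _ _ ENNReal.ofReal_ne_top]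
            simp
        _ ≤ ENNReal.ofReal (1 - (p + 1) * t / 2) * ENNReal.ofReal (Fintype.card ι * t ^ p) +
              ENNReal.ofReal (Fintype.card ι / 2 * t ^ (p + 1)) := by
            gcongr
        _ = ENNReal.ofReal (Fintype.card ι * (t ^ p * (1 - p * t / 2))) := by
            rw [← ENNReal.ofReal_mul (by linarith), ← ENNReal.ofReal_add]
            · congr 1; ring
            · exact mul_nonneg (by linarith) (by positivity)
            · positivity
        _ ≤ _ := by
            refine ENNReal.ofReal_le_ofReal (mul_le_mul_of_nonneg_left ?_ (by positivity))
            have h3 : (c + ((m + 1 : ℕ) : ℝ) / 2)⁻¹ = t * (1 + t / 2)⁻¹ := by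
              rw [ht]
              push_cast
              field_simp
              ring
            rw [h3, mul_pow]
            refine mul_le_mul_of_nonneg_left ?_ (by positivity)
            have h4 := one_add_mul_le_pow (a := (1 + t / 2)⁻¹ - 1) (by
              have : 0 < (1 + t / 2)⁻¹ := by positivity
              linarith) p
            rw [add_sub_cancel] at h4
            refine le_trans ?_ h4
            have h5 : -(t / 2) ≤ (1 + t / 2)⁻¹ - 1 := by
              have h6 : 1 - t / 2 ≤ (1 + t / 2)⁻¹ := by
                rw [← one_div, le_div_iff₀ (by positivity)]
                nlinarith
              linarith
            nlinarith

/-- Lower-tail matrix Chernoff bound for sums of independent rank-one matrices. -/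
theorem measure_exists_sum_inner_lt_le {ν : Measure (EuclideanSpace ℂ ι)}
    [IsProbabilityMeasure ν] {κ L : ℝ} (hL : 0 < L) (hκ1 : 1 ≤ κ)
    (hbound : ∀ᵐ v ∂ν, ‖v‖ ^ 2 ≤ κ) (hiso : ∀ a, ∫⁻ v, ‖inner ℂ a v‖ₑ ^ 2 ∂ν = ‖a‖ₑ ^ 2)
    {m : ℕ} (hm : 8 * κ * L ≤ m) {S : Type*} [MeasurableSpace S] (Pr : Measure S)
    [IsProbabilityMeasure Pr] (X : Fin m → S → EuclideanSpace ℂ ι)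
    (hX : ∀ i, AEMeasurable (X i) Pr) (hlaw : ∀ i, Pr.map (X i) = ν) (hindep : iIndepFun X Pr) :
    Pr {s | ∃ a, ∑ i, ‖inner ℂ (X i s) a‖ ^ 2 < 3 / 16 * m * ‖a‖ ^ 2} ≤
      ENNReal.ofReal (Fintype.card ι * Real.exp (-L)) := by
  -- The shift `c = 2 p κ` is the least allowed by the one-step bound. Taking `p ≥ 8 L` makes the
  -- final ratio at most `1 - L / p`.
  set p : ℕ := ⌈8 * L⌉₊ with hpdef
  have hp : 1 ≤ p := Nat.one_le_ceil_iff.2 (by positivity)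
  have hpR : (1 : ℝ) ≤ p := by exact_mod_cast hp
  have hpL : 8 * L ≤ p := Nat.le_ceil _
  set c : ℝ := 2 * p * κ with hc
  have hc0 : 0 < c := by positivity
  set d : ℝ := c + 3 / 16 * m with hd
  have hd0 : 0 < d := by positivity
  set B : Set (Fin m → EuclideanSpace ℂ ι) :=
    {v | ENNReal.ofReal ((d⁻¹) ^ p) ≤ ENNReal.ofReal (tracePotential p (shiftedGram c v))} with hB
  have hmeas : Measurable fun v : Fin m → EuclideanSpace ℂ ι =>
      ENNReal.ofReal (tracePotential p (shiftedGram c v)) :=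
    (measurable_tracePotential_shiftedGram p c m).ennreal_ofReal
  have hBm : MeasurableSet B := measurableSet_le measurable_const hmeas
  have hsub : {s | ∃ a, ∑ i, ‖inner ℂ (X i s) a‖ ^ 2 < 3 / 16 * m * ‖a‖ ^ 2} ⊆
      (fun s i => X i s) ⁻¹' B := by
    rintro s ⟨a, ha⟩
    obtain ⟨U, α, h, hα⟩ := exists_isDiagonalization_ge (posSemidef_shiftedGram_sub c (fun i => X i s))
    have hα0 : ∀ i, 0 < α i := fun i => hc0.trans_le (hα i)
    -- A bad direction forces some eigenvalue below `d`, and that eigenvalue alone contributes at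
    -- least `d⁻ᵖ` to the potential.
    have h1 : ∑ i, α i * ‖(star U *ᵥ a.ofLp) i‖ ^ 2 < ∑ i, d * ‖(star U *ᵥ a.ofLp) i‖ ^ 2 := by
      rw [← Finset.mul_sum, h.sum_sq, ← EuclideanSpace.norm_sq_eq]
      have h2 := (h.quadForm a.ofLp).symm.trans (quadForm_shiftedGram c _ a)
      rw [Complex.ofReal_injective h2, hd, add_mul]
      gcongr
    obtain ⟨l, -, hl⟩ := Finset.exists_lt_of_sum_lt h1
    have h3 : α l < d := lt_of_mul_lt_mul_right hl (by positivity)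
    refine ENNReal.ofReal_le_ofReal ?_
    rw [h.tracePotential (fun i => (hα0 i).ne')]
    calc (d⁻¹) ^ p ≤ ((α l)⁻¹) ^ p := by
          have := hα0 l
          gcongr
      _ ≤ _ := Finset.single_le_sum (f := fun i => ((α i)⁻¹) ^ p)
          (fun i _ => pow_nonneg (inv_pos.2 (hα0 i)).le _) (Finset.mem_univ l)
  have hjoint : Pr.map (fun s i => X i s) = Measure.pi fun _ : Fin m => ν := by
    rw [(iIndepFun_iff_map_fun_eq_pi_map hX).1 hindep]
    simp_rw [hlaw]
  have hXm : AEMeasurable (fun s i => X i s) Pr := aemeasurable_pi_lambda _ hX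
  refine (measure_mono hsub).trans ?_
  rw [← Measure.map_apply_of_aemeasurable hXm hBm, hjoint]
  have hmk := mul_meas_ge_le_lintegral (μ := Measure.pi fun _ : Fin m => ν) hmeas
    (ENNReal.ofReal ((d⁻¹) ^ p))
  have hE := hmk.trans (lintegral_tracePotential_shiftedGram_le hp hκ1 hc.symm.le hbound hiso m)
  have h4 : (Measure.pi fun _ : Fin m => ν) B ≤
      ENNReal.ofReal (d ^ p) * ENNReal.ofReal (Fintype.card ι * ((c + m / 2)⁻¹) ^ p) := by
    calc (Measure.pi fun _ : Fin m => ν) B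
        = ENNReal.ofReal (d ^ p) * (ENNReal.ofReal ((d⁻¹) ^ p) *
            (Measure.pi fun _ : Fin m => ν) B) := by
          rw [← mul_assoc, ← ENNReal.ofReal_mul (by positivity), ← mul_pow,
            mul_inv_cancel₀ hd0.ne', one_pow, ENNReal.ofReal_one, one_mul]
      _ ≤ _ := by gcongr
  refine h4.trans ?_
  rw [← ENNReal.ofReal_mul (by positivity)]
  refine ENNReal.ofReal_le_ofReal ?_
  have h5 : d * (c + m / 2)⁻¹ ≤ Real.exp (-(L / p)) := by
    refine le_trans ?_ (Real.add_one_le_exp _)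
    rw [← div_eq_mul_inv, div_le_iff₀ (by positivity)]
    -- Here `5/16 = 1/2 - 3/16`, split as `1/4` from `8 κ L ≤ m` and `1/16` from `8 L ≤ p`.
    have h6 : L * (c + m / 2) ≤ p * (5 / 16 * m) := by
      have e1 : L * c ≤ p * (m / 4) := by rw [hc]; nlinarith
      have e2 : (0 : ℝ) ≤ m := by positivity
      nlinarith
    have h7 : L / p * (c + m / 2) ≤ 5 / 16 * m := by
      rw [div_mul_eq_mul_div, div_le_iff₀ (by positivity)]
      linarith
    rw [hd]
    linarith
  calc d ^ p * (Fintype.card ι * ((c + m / 2)⁻¹) ^ p)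
      = Fintype.card ι * (d * (c + m / 2)⁻¹) ^ p := by rw [mul_pow]; ring
    _ ≤ Fintype.card ι * (Real.exp (-(L / p))) ^ p := by gcongr
    _ = Fintype.card ι * Real.exp (-L) := by
      rw [← Real.exp_nat_mul]
      congr 2
      field_simp

end Chernoff

/-! ### Orthonormal coordinates, the Christoffel function, Remez constants and change of measure. -/

section FunctionSpace

variable {D : Type*} [MeasurableSpace D]

/-- Finitely many generators give a single null set serving the whole space. -/
lemma ae_forall_mem_eq_zero {ν : Measure D} (N : Submodule ℂ (D → ℂ)) (hfg : N.FG)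
    (hN : ∀ p ∈ N, p =ᵐ[ν] 0) : ∀ᵐ x ∂ν, ∀ p ∈ N, p x = 0 := by
  obtain ⟨s, rfl⟩ := hfg
  have h : ∀ᵐ x ∂ν, ∀ p ∈ s, p x = 0 :=
    (Filter.eventually_all_finset s).2 fun p hp => hN p (Submodule.subset_span hp)
  filter_upwards [h] with x hx p hp
  induction hp using Submodule.span_induction with
  | mem p hp => exact hx p hp
  | zero => rfl
  | add p q _ _ hp hq => simp [hp, hq]
  | smul c p _ hp => simp [hp]

/-- Orthonormal coordinates, in `L²_ν`, on a finite-dimensional space of functions. -/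
lemma exists_orthonormal_coordinates {ν : Measure D} (P : Submodule ℂ (D → ℂ))
    [FiniteDimensional ℂ P] (hP : ∀ p ∈ P, MemLp p 2 ν) :
    ∃ (r : ℕ) (φ : Fin r → D → ℂ) (a : P →ₗ[ℂ] EuclideanSpace ℂ (Fin r)),
      r ≤ Module.finrank ℂ P ∧ (∀ j, φ j ∈ P) ∧
      (∀ b : EuclideanSpace ℂ (Fin r), eLpNorm (fun x => ∑ j, b j * φ j x) 2 ν = ‖b‖ₑ) ∧
      (∀ p : P, eLpNorm (p : D → ℂ) 2 ν = ‖a p‖ₑ) ∧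
      ∀ᵐ x ∂ν, ∀ p : P, (p : D → ℂ) x = ∑ j, a p j * φ j x := by
  -- `T` may have a kernel, so `r` is its rank, possibly below the dimension of `P`.
  let T : P →ₗ[ℂ] Lp ℂ 2 ν :=
    { toFun := fun p => (hP p p.2).toLp
      map_add' := fun p q => MemLp.toLp_add (hP p p.2) (hP q q.2)
      map_smul' := fun c p => MemLp.toLp_const_smul c (hP p p.2) }
  let B := stdOrthonormalBasis ℂ (LinearMap.range T)
  have hpre : ∀ j, ∃ p : P, T.rangeRestrict p = B j := fun j => T.surjective_rangeRestrict (B j)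
  choose φ hφ using hpre
  let a : P →ₗ[ℂ] EuclideanSpace ℂ (Fin (Module.finrank ℂ (LinearMap.range T))) :=
    B.repr.toLinearEquiv.toLinearMap ∘ₗ T.rangeRestrict
  have ha : ∀ p : P, eLpNorm (p : D → ℂ) 2 ν = ‖a p‖ₑ := by
    intro p
    have h1 : ‖a p‖ = ‖T p‖ := by
      change ‖B.repr (T.rangeRestrict p)‖ = _
      rw [LinearIsometryEquiv.norm_map]
      rfl
    rw [← ofReal_norm, h1, ofReal_norm]
    exact (Lp.enorm_toLp (hP p p.2)).symm
  let syn : EuclideanSpace ℂ (Fin (Module.finrank ℂ (LinearMap.range T))) →ₗ[ℂ] P :=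
    ∑ j, (EuclideanSpace.proj j).toLinearMap.smulRight (φ j)
  have hsyn : ∀ b, syn b = ∑ j, b j • φ j := by
    intro b
    simp [syn]
  have hsynapp : ∀ b x, (syn b : D → ℂ) x = ∑ j, b j * (φ j : D → ℂ) x := by
    intro b x
    rw [hsyn]
    simp
  have hasyn : ∀ b, a (syn b) = b := by
    intro b
    change B.repr (T.rangeRestrict (syn b)) = b
    rw [hsyn, map_sum]
    simp_rw [map_smul, hφ]
    rw [B.sum_repr_symm, LinearIsometryEquiv.apply_symm_apply]
  refine ⟨Module.finrank ℂ (LinearMap.range T), fun j => φ j, a, LinearMap.finrank_range_le T,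
    fun j => (φ j).2, ?_, ha, ?_⟩
  · intro b
    have := ha (syn b)
    rw [hasyn] at this
    rw [← this]
    congr 1
    ext x
    exact (hsynapp b x).symm
  · let R : P →ₗ[ℂ] (D → ℂ) := P.subtype ∘ₗ (LinearMap.id - syn ∘ₗ a)
    have hR : ∀ᵐ x ∂ν, ∀ p ∈ LinearMap.range R, p x = 0 := by
      refine ae_forall_mem_eq_zero _ (Module.Finite.iff_fg.1 inferInstance) ?_
      rintro _ ⟨p, rfl⟩
      have h1 : eLpNorm (R p) 2 ν = 0 := by
        change eLpNorm ((p - syn (a p) : P) : D → ℂ) 2 ν = 0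
        rw [ha, map_sub, hasyn, sub_self, enorm_zero]
      have hmem : R p ∈ P := (p - syn (a p) : P).2
      rwa [eLpNorm_eq_zero_iff (hP _ hmem).1 (by simp)] at h1
    filter_upwards [hR] with x hx p
    have h2 := hx (R p) ⟨p, rfl⟩
    have h3 : R p x = (p : D → ℂ) x - (syn (a p) : D → ℂ) x := rfl
    rw [h3, sub_eq_zero, hsynapp] at h2
    exact h2

/-- The normalized kernel section, with coefficients proportional to the conjugates of `φ j x`,
competes in the supremum and attains the sum. -/
lemma sum_enorm_sq_le_christoffel {ν : Measure D} {P : Submodule ℂ (D → ℂ)} {r : ℕ}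
    {φ : Fin r → D → ℂ} (hφ : ∀ j, φ j ∈ P)
    (hiso : ∀ b : EuclideanSpace ℂ (Fin r), eLpNorm (fun x => ∑ j, b j * φ j x) 2 ν = ‖b‖ₑ)
    (x : D) : ∑ j, ‖φ j x‖ₑ ^ 2 ≤ christoffel P ν x := by
  let u : EuclideanSpace ℂ (Fin r) := WithLp.toLp 2 fun j => (starRingEnd ℂ) (φ j x)
  have hu : ∑ j, ‖φ j x‖ₑ ^ 2 = ‖u‖ₑ ^ 2 := by
    rw [← ofReal_norm u, ← ENNReal.ofReal_pow (norm_nonneg _), EuclideanSpace.norm_sq_eq,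
      ENNReal.ofReal_sum_of_nonneg fun _ _ => by positivity]
    refine Finset.sum_congr rfl fun j _ => ?_
    rw [ENNReal.ofReal_pow (norm_nonneg _), ofReal_norm]
    simp [u]
  rcases eq_or_ne u 0 with h0 | h0
  · rw [hu, h0]; simp
  have hn : ‖u‖ ≠ 0 := norm_ne_zero_iff.2 h0
  let b : EuclideanSpace ℂ (Fin r) := ((‖u‖⁻¹ : ℝ) : ℂ) • u
  have hb : ‖b‖ = 1 := by
    simp only [b, norm_smul, Complex.norm_real, norm_inv, norm_norm]
    exact inv_mul_cancel₀ hn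
  have hbp : (fun y => ∑ j, b j * φ j y) ∈ P := by
    have : (fun y => ∑ j, b j * φ j y) = ∑ j, b j • φ j := by
      ext y; simp
    rw [this]
    exact Submodule.sum_mem _ fun j _ => Submodule.smul_mem _ _ (hφ j)
  have hbx : ∑ j, b j * φ j x = (‖u‖ : ℂ) := by
    have h1 : ∑ j, b j * φ j x = ((‖u‖⁻¹ : ℝ) : ℂ) * ∑ j, ((‖φ j x‖ ^ 2 : ℝ) : ℂ) := by
      rw [Finset.mul_sum]
      refine Finset.sum_congr rfl fun j _ => ?_
      have : b j = ((‖u‖⁻¹ : ℝ) : ℂ) * (starRingEnd ℂ) (φ j x) := rfl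
      rw [this, mul_assoc, Complex.conj_mul']
      push_cast; rfl
    have h2 : ∑ j, ‖φ j x‖ ^ 2 = ‖u‖ ^ 2 := by
      rw [EuclideanSpace.norm_sq_eq]
      simp [u]
    rw [h1, ← Complex.ofReal_sum, h2, ← Complex.ofReal_mul]
    congr 1
    field_simp
  have hbe : ‖b‖ₑ = 1 := by rw [← ofReal_norm, hb, ENNReal.ofReal_one]
  rw [hu, christoffel]
  refine le_trans (le_of_eq ?_) (le_iSup₂ (fun y => ∑ j, b j * φ j y)
    ⟨hbp, by rw [hiso, hbe, one_pow]⟩)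
  change _ = ‖∑ j, b j * φ j x‖ₑ ^ 2
  rw [hbx, ← ofReal_norm, ← ofReal_norm, Complex.norm_real, norm_norm]

lemma eLpNorm_le_remez_mul {P : Submodule ℂ (D → ℂ)} {ϱ : Measure D} [IsProbabilityMeasure ϱ]
    (hP : ∀ p ∈ P, MemLp p 2 ϱ) (hone : ∃ p ∈ P, p =ᵐ[ϱ] fun _ => (1 : ℂ)) {Ω : Set D}
    (hΩpos : 0 < ϱ Ω) {q : ℝ≥0∞} (hq : 1 ≤ q) (hR : remez P ϱ Ω q 2 ≠ ∞) {p : D → ℂ}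
    (hp : p ∈ P) : eLpNorm p q ϱ ≤ remez P ϱ Ω q 2 * eLpNorm p 2 (ϱ.restrict Ω) := by
  have hle : ∀ g ∈ P, 0 < eLpNorm g 2 (ϱ.restrict Ω) → eLpNorm g 2 (ϱ.restrict Ω) ≤ 1 →
      eLpNorm g q ϱ ≤ remez P ϱ Ω q 2 := fun g hg h0 h1 =>
    le_iSup₂ (f := fun (p : D → ℂ) (_ : p ∈ {p : D → ℂ | p ∈ P ∧ 0 < eLpNorm p 2 (ϱ.restrict Ω) ∧
      eLpNorm p 2 (ϱ.restrict Ω) ≤ 1}) => eLpNorm p q ϱ) g ⟨hg, h0, h1⟩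
  rcases eq_or_ne (eLpNorm p 2 (ϱ.restrict Ω)) 0 with h0 | h0
  -- If `p` vanishes on `Ω`, every `o + k p` has the same norm over `Ω` as `o`, namely `ϱ(Ω)^{1/2} ∈
  -- (0, 1]`, and is admissible. A finite Remez constant then forces `p` to have norm zero on `D`.
  · obtain ⟨o, ho, hoe⟩ := hone
    have hoΩ : eLpNorm o 2 (ϱ.restrict Ω) = ϱ Ω ^ (1 / (2 : ℝ)) := by
      rw [eLpNorm_congr_ae (ae_restrict_of_ae hoe), eLpNorm_const _ (by simp)]
      · simp
      · intro h
        rw [Measure.restrict_eq_zero] at h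
        exact hΩpos.ne' h
    have hpz : p =ᵐ[ϱ.restrict Ω] 0 :=
      (eLpNorm_eq_zero_iff (hP p hp).1.restrict (by simp)).1 h0
    have hbd : ∀ k : ℕ, eLpNorm (o + (k : ℂ) • p) q ϱ ≤ remez P ϱ Ω q 2 := by
      intro k
      have he : eLpNorm (o + (k : ℂ) • p) 2 (ϱ.restrict Ω) = eLpNorm o 2 (ϱ.restrict Ω) := by
        refine eLpNorm_congr_ae ?_
        filter_upwards [hpz] with x hx
        simp [hx]
      refine hle _ (P.add_mem ho (P.smul_mem _ hp)) ?_ ?_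
      · rw [he, hoΩ]
        exact ENNReal.rpow_pos hΩpos (measure_ne_top _ _)
      · rw [he, hoΩ]
        exact ENNReal.rpow_le_one prob_le_one (by norm_num)
    have hbd2 : ∀ k : ℕ, (k : ℝ≥0∞) * eLpNorm p q ϱ ≤ 2 * remez P ϱ Ω q 2 := by
      intro k
      have e1 : (k : ℝ≥0∞) * eLpNorm p q ϱ = eLpNorm ((k : ℂ) • p) q ϱ := by
        rw [eLpNorm_const_smul]
        congr 1
        rw [← ofReal_norm]
        simp
      have e2 : (k : ℂ) • p = (o + (k : ℂ) • p) - (o + ((0 : ℕ) : ℂ) • p) := by simp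
      rw [e1, e2]
      refine (eLpNorm_sub_le ?_ ?_ hq).trans ?_
      · exact (hP o ho).1.add ((hP p hp).1.const_smul _)
      · exact (hP o ho).1.add ((hP p hp).1.const_smul _)
      · rw [two_mul]
        exact add_le_add (hbd k) (hbd 0)
    have : eLpNorm p q ϱ = 0 := by
      by_contra hne
      have htop : 2 * remez P ϱ Ω q 2 ≠ ∞ := ENNReal.mul_ne_top (by simp) hR
      obtain ⟨k, hk⟩ := ENNReal.exists_nat_mul_gt hne htop
      exact absurd (hbd2 k) (not_le.2 hk)
    rw [this]
    exact zero_le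
  · have htop : eLpNorm p 2 (ϱ.restrict Ω) ≠ ∞ := ((hP p hp).restrict Ω).2.ne
    set N := (eLpNorm p 2 (ϱ.restrict Ω)).toReal with hN
    have hNpos : 0 < N := ENNReal.toReal_pos h0 htop
    have hofN : ENNReal.ofReal N = eLpNorm p 2 (ϱ.restrict Ω) := ENNReal.ofReal_toReal htop
    have hc : ‖((N⁻¹ : ℝ) : ℂ)‖ₑ = (eLpNorm p 2 (ϱ.restrict Ω))⁻¹ := by
      rw [← ofReal_norm, Complex.norm_real, norm_inv, Real.norm_of_nonneg hNpos.le,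
        ENNReal.ofReal_inv_of_pos hNpos, hofN]
    have h1 : eLpNorm (((N⁻¹ : ℝ) : ℂ) • p) 2 (ϱ.restrict Ω) = 1 := by
      rw [eLpNorm_const_smul, hc, ENNReal.inv_mul_cancel h0 htop]
    have h2 := hle _ (P.smul_mem ((N⁻¹ : ℝ) : ℂ) hp) (by rw [h1]; exact one_pos) h1.le
    rw [eLpNorm_const_smul, hc] at h2
    calc eLpNorm p q ϱ = eLpNorm p 2 (ϱ.restrict Ω) *
          ((eLpNorm p 2 (ϱ.restrict Ω))⁻¹ * eLpNorm p q ϱ) := by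
          rw [← mul_assoc, ENNReal.mul_inv_cancel h0 htop, one_mul]
      _ ≤ eLpNorm p 2 (ϱ.restrict Ω) * remez P ϱ Ω q 2 := by gcongr
      _ = _ := mul_comm _ _

lemma measurable_weight (μ ϱ : Measure D) : Measurable (weight μ ϱ) :=
  (Measure.measurable_rnDeriv μ ϱ).inv

/-- Only an inequality, because `v * v⁻¹ = 0` where `v = 0`; positivity of `v` gives equality on `Ω`
in `setLIntegral_weight_mul`. -/
lemma lintegral_weight_mul_le {μ ϱ : Measure D} [SigmaFinite μ] [SigmaFinite ϱ] (hμϱ : μ ≪ ϱ)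
    {g : D → ℝ≥0∞} (hg : AEMeasurable g ϱ) :
    ∫⁻ x, weight μ ϱ x * g x ∂μ ≤ ∫⁻ x, g x ∂ϱ := by
  have e : ∫⁻ x, (weight μ ϱ * g) x ∂μ =
      ∫⁻ x, (weight μ ϱ * g) x ∂(ϱ.withDensity (μ.rnDeriv ϱ)) := by
    rw [Measure.withDensity_rnDeriv_eq μ ϱ hμϱ]
  refine (le_of_eq e).trans ?_
  rw [lintegral_withDensity_eq_lintegral_mul₀ (Measure.measurable_rnDeriv μ ϱ).aemeasurable
    ((measurable_weight μ ϱ).aemeasurable.mul hg)]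
  refine lintegral_mono fun x => ?_
  simp only [Pi.mul_apply, weight, ← mul_assoc]
  exact mul_le_of_le_one_left' (ENNReal.mul_inv_le_one _)

lemma setLIntegral_weight_mul {μ ϱ : Measure D} [SigmaFinite μ] [SigmaFinite ϱ] (hμϱ : μ ≪ ϱ)
    {Ω : Set D} (hΩ : MeasurableSet Ω) (hv : ∀ᵐ x ∂(ϱ.restrict Ω), 0 < μ.rnDeriv ϱ x)
    {g : D → ℝ≥0∞} (hg : AEMeasurable g ϱ) :
    ∫⁻ x in Ω, weight μ ϱ x * g x ∂μ = ∫⁻ x in Ω, g x ∂ϱ := by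
  have e : ∫⁻ x in Ω, (weight μ ϱ * g) x ∂μ =
      ∫⁻ x in Ω, (weight μ ϱ * g) x ∂(ϱ.withDensity (μ.rnDeriv ϱ)) := by
    rw [Measure.withDensity_rnDeriv_eq μ ϱ hμϱ]
  refine e.trans ?_
  rw [restrict_withDensity hΩ, lintegral_withDensity_eq_lintegral_mul₀
    (Measure.measurable_rnDeriv μ ϱ).aemeasurable
    ((measurable_weight μ ϱ).aemeasurable.mul hg.restrict)]
  refine lintegral_congr_ae ?_
  filter_upwards [hv, ae_restrict_of_ae (Measure.rnDeriv_lt_top μ ϱ)] with x h0 h1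
  simp only [Pi.mul_apply, weight, ← mul_assoc]
  rw [ENNReal.mul_inv_cancel h0.ne' h1.ne, one_mul]

end FunctionSpace

/-! ### Sampling vectors, Markov's inequality and the discrete least-squares problem. -/

section Sampling

variable {D : Type*} [MeasurableSpace D]

/-- The sampling vector `√w 1_Ω (φ̄ⱼ)ⱼ` in orthonormal coordinates. -/
lemma exists_sampling_vector {ϱ μ : Measure D} [IsProbabilityMeasure ϱ] [IsProbabilityMeasure μ]
    (hμϱ : μ ≪ ϱ) (P : Submodule ℂ (D → ℂ)) [FiniteDimensional ℂ P]
    (hP : ∀ p ∈ P, MemLp p 2 ϱ) {Ω : Set D} (hΩ : MeasurableSet Ω)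
    (hv : ∀ᵐ x ∂(ϱ.restrict Ω), 0 < μ.rnDeriv ϱ x)
    (hκ : kappa (weight μ ϱ) P (ϱ.restrict Ω) ≠ ∞) :
    ∃ (r : ℕ) (a : P → EuclideanSpace ℂ (Fin r)) (ξ : D → EuclideanSpace ℂ (Fin r)),
      r ≤ Module.finrank ℂ P ∧ Measurable ξ ∧
      (∀ p : P, eLpNorm (p : D → ℂ) 2 (ϱ.restrict Ω) = ‖a p‖ₑ) ∧
      (∀ᵐ x ∂μ, ‖ξ x‖ ^ 2 ≤ (kappa (weight μ ϱ) P (ϱ.restrict Ω)).toReal) ∧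
      (∀ b, ∫⁻ x, ‖inner ℂ b (ξ x)‖ₑ ^ 2 ∂μ = ‖b‖ₑ ^ 2) ∧
      ∀ᵐ x ∂μ, ∀ p : P, ‖inner ℂ (ξ x) (a p)‖ₑ ^ 2 ≤ weight μ ϱ x * ‖(p : D → ℂ) x‖ₑ ^ 2 := by
  obtain ⟨r, φ, a, hr, hφ, hsyn, ha, hexp⟩ :=
    exists_orthonormal_coordinates (ν := ϱ.restrict Ω) P fun p hp => (hP p hp).restrict Ω
  set w := weight μ ϱ with hw
  have hφm : ∀ j, AEStronglyMeasurable (φ j) ϱ := fun j => (hP _ (hφ j)).1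
  let σ : D → ℝ := Ω.indicator fun x => Real.sqrt (w x).toReal
  -- Strongly measurable representatives make `ξ` measurable everywhere; they agree with `φ j` for
  -- `μ`-almost every point.
  let ξ : D → EuclideanSpace ℂ (Fin r) := fun x =>
    WithLp.toLp 2 fun j => (σ x : ℂ) * (starRingEnd ℂ) ((hφm j).mk _ x)
  have hσm : Measurable σ :=
    ((measurable_weight μ ϱ).ennreal_toReal.sqrt).indicator hΩ
  have hξm : Measurable ξ := by
    refine (MeasurableEquiv.toLp 2 (Fin r → ℂ)).measurable.comp (measurable_pi_lambda _ fun j => ?_)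
    exact (Complex.measurable_ofReal.comp hσm).mul
      (Complex.continuous_conj.measurable.comp (hφm j).stronglyMeasurable_mk.measurable)
  have hmk : ∀ᵐ x ∂μ, ∀ j, (hφm j).mk _ x = φ j x :=
    ae_all_iff.2 fun j => hμϱ.ae_le (hφm j).ae_eq_mk.symm
  have hwfin : ∀ᵐ x ∂μ, w x ≠ ∞ := by
    filter_upwards [Measure.rnDeriv_pos hμϱ] with x hx
    exact ENNReal.inv_ne_top.2 hx.ne'
  have hσsq : ∀ x, x ∈ Ω → w x ≠ ∞ → ‖(σ x : ℂ)‖ₑ ^ 2 = w x := by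
    intro x hx hwx
    rw [← ofReal_norm, ← ENNReal.ofReal_pow (norm_nonneg _), Complex.norm_real]
    simp only [σ, Set.indicator_of_mem hx]
    rw [Real.norm_of_nonneg (Real.sqrt_nonneg _), Real.sq_sqrt ENNReal.toReal_nonneg,
      ENNReal.ofReal_toReal hwx]
  have hinner : ∀ᵐ x ∂μ, ∀ b, ‖inner ℂ (ξ x) b‖ₑ ^ 2 =
      Ω.indicator (fun x => w x * ‖∑ j, b j * φ j x‖ₑ ^ 2) x := by
    filter_upwards [hmk, hwfin] with x hx hwx b
    have h1 : inner ℂ (ξ x) b = (σ x : ℂ) * ∑ j, b j * φ j x := by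
      rw [PiLp.inner_apply, Finset.mul_sum]
      refine Finset.sum_congr rfl fun j _ => ?_
      simp [ξ, hx j]
      ring
    rw [h1, enorm_mul, mul_pow]
    by_cases hxΩ : x ∈ Ω
    · rw [hσsq x hxΩ hwx, Set.indicator_of_mem hxΩ]
    · simp [σ, hxΩ]
  have hrestr : μ.restrict Ω ≪ ϱ.restrict Ω := hμϱ.restrict Ω
  have hK : ∀ᵐ x ∂μ, x ∈ Ω → w x * christoffel P (ϱ.restrict Ω) x ≤
      kappa w P (ϱ.restrict Ω) :=
    (ae_restrict_iff' hΩ).1 (hrestr.ae_le (ENNReal.ae_le_essSup _))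
  refine ⟨r, a, ξ, hr, hξm, ha, ?_, ?_, ?_⟩
  · filter_upwards [hmk, hwfin, hK] with x hx hwx hKx
    rw [← ENNReal.ofReal_le_iff_le_toReal hκ]
    by_cases hxΩ : x ∈ Ω
    · refine le_trans ?_ (hKx hxΩ)
      rw [EuclideanSpace.norm_sq_eq, ENNReal.ofReal_sum_of_nonneg fun _ _ => by positivity]
      calc ∑ j, ENNReal.ofReal (‖ξ x j‖ ^ 2) = w x * ∑ j, ‖φ j x‖ₑ ^ 2 := by
            rw [Finset.mul_sum]
            refine Finset.sum_congr rfl fun j _ => ?_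
            rw [ENNReal.ofReal_pow (norm_nonneg _), ofReal_norm, ← hσsq x hxΩ hwx, ← mul_pow]
            simp only [ξ, hx j, enorm_mul, RCLike.enorm_conj]
        _ ≤ _ := by
            gcongr
            exact sum_enorm_sq_le_christoffel hφ hsyn x
    · have : ξ x = 0 := by
        ext j
        simp [ξ, σ, hxΩ]
      simp [this]
  · intro b
    have h1 : ∀ᵐ x ∂μ, ‖inner ℂ b (ξ x)‖ₑ ^ 2 =
        Ω.indicator (fun x => w x * ‖∑ j, b j * φ j x‖ₑ ^ 2) x := by
      filter_upwards [hinner] with x hx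
      rw [← hx, ← inner_conj_symm, RCLike.enorm_conj]
    have hm : AEStronglyMeasurable (fun x => ∑ j, b j * φ j x) ϱ :=
      Finset.aestronglyMeasurable_fun_sum _ fun j _ => (hφm j).const_mul _
    rw [lintegral_congr_ae h1, lintegral_indicator hΩ,
      setLIntegral_weight_mul hμϱ hΩ hv (hm.enorm.pow_const 2), ← hsyn b,
      eLpNorm_eq_lintegral_rpow_enorm_toReal (by simp) (by simp)]
    simp only [ENNReal.toReal_ofNat, ENNReal.rpow_ofNat]
    rw [← ENNReal.rpow_natCast, ← ENNReal.rpow_mul]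
    simp
  · have hexp' : ∀ᵐ x ∂μ, x ∈ Ω → ∀ p : P, (p : D → ℂ) x = ∑ j, a p j * φ j x :=
      (ae_restrict_iff' hΩ).1 (hrestr.ae_le hexp)
    filter_upwards [hinner, hexp'] with x hx hxe p
    rw [hx]
    by_cases hxΩ : x ∈ Ω
    · rw [Set.indicator_of_mem hxΩ, hxe hxΩ p]
    · rw [Set.indicator_of_notMem hxΩ]; exact zero_le

/-- Markov's inequality for an empirical sum. -/
lemma measure_sum_comp_gt_le {μ : Measure D} {m : ℕ} {S : Type*} [MeasurableSpace S]
    {Pr : Measure S} {x : Fin m → S → D} (hx : ∀ i, AEMeasurable (x i) Pr)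
    (hlaw : ∀ i, Pr.map (x i) = μ) {g : D → ℝ≥0∞} (hg : AEMeasurable g μ) {C : ℝ≥0∞}
    (hC : C ≠ ∞) (hgC : ∫⁻ y, g y ∂μ ≤ C) {δ : ℝ} (hδ : 0 < δ) :
    Pr {s | (ENNReal.ofReal δ)⁻¹ * (m * C) < ∑ i, g (x i s)} ≤ ENNReal.ofReal δ := by
  have hgx : ∀ i, AEMeasurable (fun s => g (x i s)) Pr := fun i =>
    AEMeasurable.comp_aemeasurable (by rwa [hlaw i]) (hx i)
  have hint : ∫⁻ s, ∑ i, g (x i s) ∂Pr ≤ m * C := by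
    rw [lintegral_finsetSum' _ fun i _ => hgx i]
    have : ∀ i, ∫⁻ s, g (x i s) ∂Pr ≤ C := by
      intro i
      rw [← lintegral_map' (by rwa [hlaw i]) (hx i), hlaw i]
      exact hgC
    calc ∑ i, ∫⁻ s, g (x i s) ∂Pr ≤ ∑ _i : Fin m, C := Finset.sum_le_sum fun i _ => this i
      _ = m * C := by simp
  have hsum : AEMeasurable (fun s => ∑ i, g (x i s)) Pr :=
    Finset.aemeasurable_fun_sum _ fun i _ => hgx i
  have hδ0 : ENNReal.ofReal δ ≠ 0 := by simpa using hδ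
  have hmC : (m : ℝ≥0∞) * C ≠ ∞ := ENNReal.mul_ne_top (ENNReal.natCast_ne_top m) hC
  -- With threshold zero Markov's inequality says nothing, but the sum then vanishes almost surely
  -- and the event is strict.
  rcases eq_or_ne ((m : ℝ≥0∞) * C) 0 with h0 | h0
  · rw [h0] at hint
    have h1 := (lintegral_eq_zero_iff' hsum).1 (le_antisymm hint zero_le)
    refine le_trans (le_of_eq ?_) zero_le
    rw [h0, mul_zero]
    refine measure_mono_null (fun s hs => ?_) h1
    rw [Set.mem_ofPred_eq] at hs
    exact hs.ne'
  · refine (measure_mono (t := {s | (ENNReal.ofReal δ)⁻¹ * (m * C) ≤ ∑ i, g (x i s)})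
      fun s hs => by rw [Set.mem_ofPred_eq] at hs ⊢; exact hs.le).trans ((meas_ge_le_lintegral_div hsum ?_ ?_).trans ?_)
    · exact mul_ne_zero (ENNReal.inv_ne_zero.2 ENNReal.ofReal_ne_top) h0
    · exact ENNReal.mul_ne_top (ENNReal.inv_ne_top.2 hδ0) hmC
    · refine ENNReal.div_le_of_le_mul ?_
      rw [← mul_assoc, ENNReal.mul_inv_cancel hδ0 ENNReal.ofReal_ne_top, one_mul]
      exact hint

/-- The weighted discrete `ℓ²` seminorm. -/
noncomputable def weightedNorm {m : ℕ} (W : Fin m → ℝ≥0∞) (h : Fin m → ℂ) : ℝ≥0∞ :=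
  (∑ i, W i * ‖h i‖ₑ ^ 2) ^ (1 / (2 : ℝ))

lemma weightedNorm_sq {m : ℕ} (W : Fin m → ℝ≥0∞) (h : Fin m → ℂ) :
    weightedNorm W h ^ 2 = ∑ i, W i * ‖h i‖ₑ ^ 2 := by
  rw [weightedNorm, ← ENNReal.rpow_natCast, ← ENNReal.rpow_mul]
  simp

lemma weightedNorm_sub_le {m : ℕ} (W : Fin m → ℝ≥0∞) (g h : Fin m → ℂ) :
    weightedNorm W (g - h) ≤ weightedNorm W g + weightedNorm W h := by
  have key : ∀ h : Fin m → ℂ,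
      weightedNorm W h = (∑ i, (W i ^ (1 / (2 : ℝ)) * ‖h i‖ₑ) ^ (2 : ℝ)) ^ (1 / (2 : ℝ)) := by
    intro h
    rw [weightedNorm]
    congr 1
    refine Finset.sum_congr rfl fun i _ => ?_
    rw [ENNReal.mul_rpow_of_nonneg _ _ (by norm_num), ← ENNReal.rpow_mul]
    simp
  rw [key, key, key]
  refine le_trans ?_ (ENNReal.Lp_add_le Finset.univ _ _ one_le_two)
  gcongr with i
  rw [← mul_add]
  gcongr
  exact enorm_sub_le

/-- Write `g - p` as the residual of `p` minus that of `g`; by minimality the second is no larger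
than the first. -/
lemma weightedNorm_sub_minimizer_le {D : Type*} {m : ℕ} (hm : m ≠ 0) {P : Submodule ℂ (D → ℂ)}
    {w : D → ℝ≥0∞} {z : Fin m → D} {f g p : D → ℂ} {e : Fin m → ℂ}
    (hg : IsMinimizer P w z (fun i => f (z i) + e i) g) (hp : p ∈ P) :
    weightedNorm (fun i => w (z i)) (fun i => g (z i) - p (z i)) ≤
      2 * (weightedNorm (fun i => w (z i)) (fun i => f (z i) - p (z i)) +
        weightedNorm (fun i => w (z i)) e) := by
  set W : Fin m → ℝ≥0∞ := fun i => w (z i)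
  have hneg : ∀ h : Fin m → ℂ, weightedNorm W (-h) = weightedNorm W h := by
    intro h; simp [weightedNorm]
  have hmin : weightedNorm W (fun i => f (z i) + e i - g (z i)) ≤
      weightedNorm W (fun i => f (z i) + e i - p (z i)) := by
    have h1 := hg.2 p hp
    unfold objective at h1
    rw [ENNReal.mul_le_mul_iff_right (by simp) (by simpa using hm)] at h1
    unfold weightedNorm
    gcongr
  have h2 : weightedNorm W (fun i => f (z i) + e i - p (z i)) ≤
      weightedNorm W (fun i => f (z i) - p (z i)) + weightedNorm W e := by
    have := weightedNorm_sub_le W (fun i => f (z i) - p (z i)) (-e)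
    rw [hneg] at this
    convert this using 2
    ext i; simp; ring
  have h3 := weightedNorm_sub_le W (fun i => f (z i) + e i - p (z i))
    (fun i => f (z i) + e i - g (z i))
  have h4 : ((fun i => f (z i) + e i - p (z i)) - fun i => f (z i) + e i - g (z i)) =
      fun i => g (z i) - p (z i) := by
    ext i; simp
  rw [h4] at h3
  rw [two_mul]
  exact h3.trans (add_le_add h2 (hmin.trans h2))

/-- The crude bound `|eᵢ| ≤ ‖e‖₂` isolates `∑ w(xᵢ)`, which does not involve `e`; hence one event
serves all `e` at once. -/
lemma weightedNorm_le_mul_enorm {m : ℕ} (W : Fin m → ℝ≥0∞) (e : EuclideanSpace ℂ (Fin m)) :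
    weightedNorm W e ^ 2 ≤ (∑ i, W i) * ‖e‖ₑ ^ 2 := by
  rw [weightedNorm_sq, Finset.sum_mul]
  refine Finset.sum_le_sum fun i _ => ?_
  gcongr
  exact enorm_le_iff_norm_le.2 (PiLp.norm_apply_le e i)

end Sampling

/-! ### Assembling the deterministic error bound. -/

section ErrorBound

/-- Integrate Cauchy–Schwarz. -/
lemma one_le_of_isotropic {D E : Type*} [MeasurableSpace D] [NormedAddCommGroup E]
    [InnerProductSpace ℂ E] {μ : Measure D} [IsProbabilityMeasure μ] {ξ : D → E} {κ : ℝ}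
    (hbound : ∀ᵐ x ∂μ, ‖ξ x‖ ^ 2 ≤ κ) {b : E} (hb : b ≠ 0)
    (hiso : ∫⁻ x, ‖inner ℂ b (ξ x)‖ₑ ^ 2 ∂μ = ‖b‖ₑ ^ 2) : 1 ≤ κ := by
  have h1 : ‖b‖ₑ ^ 2 ≤ ‖b‖ₑ ^ 2 * ENNReal.ofReal κ := by
    calc ‖b‖ₑ ^ 2 = ∫⁻ x, ‖inner ℂ b (ξ x)‖ₑ ^ 2 ∂μ := hiso.symm
      _ ≤ ∫⁻ _, ‖b‖ₑ ^ 2 * ENNReal.ofReal κ ∂μ := by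
          refine lintegral_mono_ae ?_
          filter_upwards [hbound] with x hx
          calc ‖inner ℂ b (ξ x)‖ₑ ^ 2 ≤ (‖b‖ₑ * ‖ξ x‖ₑ) ^ 2 := by
                gcongr
                rw [← ofReal_norm, ← ofReal_norm b, ← ofReal_norm (ξ x),
                  ← ENNReal.ofReal_mul (norm_nonneg _)]
                exact ENNReal.ofReal_le_ofReal (norm_inner_le_norm _ _)
            _ = ‖b‖ₑ ^ 2 * ENNReal.ofReal (‖ξ x‖ ^ 2) := by
                rw [mul_pow, ENNReal.ofReal_pow (norm_nonneg _), ofReal_norm]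
            _ ≤ _ := by gcongr
      _ = _ := by simp
  have hb0 : ‖b‖ₑ ^ 2 ≠ 0 := by simpa using hb
  have hbt : ‖b‖ₑ ^ 2 ≠ ∞ := by simp
  by_contra hlt
  have h2 : ENNReal.ofReal κ < 1 := by
    rw [← ENNReal.ofReal_one]
    exact (ENNReal.ofReal_lt_ofReal_iff one_pos).2 (not_le.1 hlt)
  have h3 : ‖b‖ₑ ^ 2 * ENNReal.ofReal κ < ‖b‖ₑ ^ 2 * 1 := (ENNReal.mul_lt_mul_iff_right hb0 hbt).2 h2
  rw [mul_one] at h3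
  exact absurd h1 (not_le.2 h3)

/-- The constant is `8 / √ε = 2 √(3m/ε) / √(3m/16)`. -/
lemma le_eight_div_sqrt_mul {m : ℕ} (hm : m ≠ 0) {ε : ℝ} (hε : 0 < ε) {X N N₁ N₂ A B : ℝ≥0∞}
    (hX : ENNReal.ofReal (3 / 16 * m) * X ^ 2 ≤ N ^ 2) (hN : N ≤ 2 * (N₁ + N₂))
    (h₁ : N₁ ^ 2 ≤ (ENNReal.ofReal (ε / 3))⁻¹ * (m * A ^ 2))
    (h₂ : N₂ ^ 2 ≤ (ENNReal.ofReal (ε / 3))⁻¹ * m * B ^ 2) :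
    X ≤ 8 / ENNReal.ofReal (Real.sqrt ε) * (A + B) := by
  have hmR : (0 : ℝ) < m := by exact_mod_cast Nat.pos_of_ne_zero hm
  set K : ℝ≥0∞ := ENNReal.ofReal (Real.sqrt (3 / ε * m)) with hK
  have hKsq : K ^ 2 = (ENNReal.ofReal (ε / 3))⁻¹ * m := by
    rw [hK, ← ENNReal.ofReal_pow (Real.sqrt_nonneg _), Real.sq_sqrt (by positivity),
      ← ENNReal.ofReal_inv_of_pos (by positivity), inv_div, ENNReal.ofReal_mul (by positivity),
      ENNReal.ofReal_natCast]
  have hpow : ∀ {a b : ℝ≥0∞}, a ^ 2 ≤ b ^ 2 → a ≤ b := fun h =>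
    (ENNReal.pow_le_pow_left_iff two_ne_zero).1 h
  have e₁ : N₁ ≤ K * A := hpow (by rw [mul_pow, hKsq, mul_assoc]; exact h₁)
  have e₂ : N₂ ≤ K * B := hpow (by rw [mul_pow, hKsq]; exact h₂)
  have hc : ENNReal.ofReal (Real.sqrt (3 / 16 * m)) * X ≤ 2 * (K * (A + B)) := by
    refine le_trans (hpow ?_) (hN.trans ?_)
    · rw [mul_pow, ← ENNReal.ofReal_pow (Real.sqrt_nonneg _), Real.sq_sqrt (by positivity)]
      exact hX
    · rw [mul_add K]
      gcongr
  set c : ℝ := Real.sqrt (3 / 16 * m) with hcdef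
  have hc0 : 0 < c := Real.sqrt_pos.2 (by positivity)
  have hsε : 0 < Real.sqrt ε := Real.sqrt_pos.2 hε
  have hconst : ENNReal.ofReal c⁻¹ * (2 * K) = 8 / ENNReal.ofReal (Real.sqrt ε) := by
    rw [hK, show (2 : ℝ≥0∞) = ENNReal.ofReal 2 by simp, show (8 : ℝ≥0∞) = ENNReal.ofReal 8 by simp,
      ← ENNReal.ofReal_mul (by norm_num), ← ENNReal.ofReal_mul (by positivity),
      ← ENNReal.ofReal_div_of_pos hsε]
    congr 1
    have h16 : Real.sqrt (3 / ε * m) * Real.sqrt ε = 4 * c := by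
      rw [← Real.sqrt_mul (by positivity), hcdef,
        show (4 : ℝ) = Real.sqrt 16 by rw [show (16 : ℝ) = 4 ^ 2 by norm_num]; simp,
        ← Real.sqrt_mul (by norm_num)]
      congr 1
      field_simp
    rw [eq_div_iff hsε.ne', mul_assoc, mul_assoc, h16]
    field_simp
    norm_num
  calc X = ENNReal.ofReal c⁻¹ * (ENNReal.ofReal c * X) := by
        rw [← mul_assoc, ← ENNReal.ofReal_mul (by positivity), inv_mul_cancel₀ hc0.ne',
          ENNReal.ofReal_one, one_mul]
    _ ≤ ENNReal.ofReal c⁻¹ * (2 * (K * (A + B))) := by gcongr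
    _ = ENNReal.ofReal c⁻¹ * (2 * K) * (A + B) := by ring
    _ = _ := by rw [hconst]

lemma eLpNorm_sub_le_of_remez {D : Type*} [MeasurableSpace D] {P : Submodule ℂ (D → ℂ)}
    {ϱ : Measure D} [IsProbabilityMeasure ϱ] (hP : ∀ p ∈ P, MemLp p 2 ϱ)
    (hone : ∃ p ∈ P, p =ᵐ[ϱ] fun _ => (1 : ℂ)) {Ω : Set D} (hΩpos : 0 < ϱ Ω) {q : ℝ≥0∞}
    (hq : 1 ≤ q) (hR : remez P ϱ Ω q 2 ≠ ∞) {f g h : D → ℂ} (hf : MemLp f 2 ϱ) (hg : g ∈ P)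
    (hh : h ∈ P) {s T : ℝ≥0∞} (hT : eLpNorm (h - g) 2 (ϱ.restrict Ω) ≤ 8 / s * T) :
    eLpNorm (f - h) q ϱ ≤ eLpNorm (f - g) q ϱ + 8 * remez P ϱ Ω q 2 / s * T := by
  have e : f - h = (f - g) - (h - g) := by abel
  rw [e]
  refine (eLpNorm_sub_le (hf.1.sub (hP g hg).1) ((hP h hh).1.sub (hP g hg).1) hq).trans ?_
  gcongr
  refine (eLpNorm_le_remez_mul hP hone hΩpos hq hR (P.sub_mem hh hg)).trans ?_
  calc remez P ϱ Ω q 2 * eLpNorm (h - g) 2 (ϱ.restrict Ω) ≤ remez P ϱ Ω q 2 * (8 / s * T) := by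
        gcongr
    _ = _ := by simp only [div_eq_mul_inv]; ring

end ErrorBound

end WLS

/-! ### The main theorem. -/

theorem mainTheorem1 {D : Type*} [MeasurableSpace D]
    (ϱ μ : Measure D) [IsProbabilityMeasure ϱ] [IsProbabilityMeasure μ] (hμϱ : μ ≪ ϱ)
    (P : Submodule ℂ (D → ℂ)) [FiniteDimensional ℂ P] (hP : ∀ p ∈ P, MemLp p 2 ϱ)
    (hone : ∃ p ∈ P, p =ᵐ[ϱ] fun _ => (1 : ℂ))
    (n : ℕ) (hn : Module.finrank ℂ P = n)
    (Ω : Set D) (hΩ : NullMeasurableSet Ω ϱ) (hΩpos : 0 < ϱ Ω)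
    (hv : ∀ᵐ x ∂(ϱ.restrict Ω), 0 < μ.rnDeriv ϱ x)
    (f : D → ℂ) (hf : MemLp f 2 ϱ)
    (fn : D → ℂ) (hfn : WLS.IsBestApprox P ϱ f fn)
    (ε : ℝ) (hε0 : 0 < ε) (hε1 : ε < 1)
    (m : ℕ)
    (hm : 8 * WLS.kappa (WLS.weight μ ϱ) P (ϱ.restrict Ω) *
      ENNReal.ofReal (Real.log (3 * n / ε)) ≤ (m : ℝ≥0∞))
    {S : Type*} [MeasurableSpace S] (Pr : Measure S) [IsProbabilityMeasure Pr]
    (x : Fin m → S → D) (hx : ∀ i, AEMeasurable (x i) Pr)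
    (hlaw : ∀ i, Pr.map (x i) = μ) (hindep : iIndepFun x Pr) :
    ∃ E : Set S, MeasurableSet E ∧ ENNReal.ofReal (1 - ε) ≤ Pr E ∧
      ∀ s ∈ E, ∀ (e : EuclideanSpace ℂ (Fin m)) (fhat : D → ℂ),
        WLS.IsMinimizer P (WLS.weight μ ϱ) (fun i => x i s) (fun i => f (x i s) + e i) fhat →
        (WLS.remez P ϱ Ω 2 2 ≠ ∞ →
          eLpNorm (f - fhat) 2 ϱ ≤ eLpNorm (f - fn) 2 ϱ +
            8 * WLS.remez P ϱ Ω 2 2 / ENNReal.ofReal (Real.sqrt ε) *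
              (eLpNorm (f - fn) 2 ϱ + ‖e‖ₑ)) ∧
        (WLS.remez P ϱ Ω ∞ 2 ≠ ∞ →
          eLpNorm (f - fhat) ∞ ϱ ≤ eLpNorm (f - fn) ∞ ϱ +
            8 * WLS.remez P ϱ Ω ∞ 2 / ENNReal.ofReal (Real.sqrt ε) *
              (eLpNorm (f - fn) 2 ϱ + ‖e‖ₑ)) := by
  -- `Ω` is only null-measurable; its measurable hull induces the same restricted measure.
  have hres : ϱ.restrict (toMeasurable ϱ Ω) = ϱ.restrict Ω :=
    Measure.restrict_congr_set hΩ.toMeasurable_ae_eq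
  obtain ⟨o, hoP, hoe⟩ := hone
  have ho0 : eLpNorm o 2 (ϱ.restrict Ω) ≠ 0 := by
    intro h0
    rw [eLpNorm_eq_zero_iff (hP o hoP).1.restrict (by simp)] at h0
    have h1 : ∀ᵐ _ ∂(ϱ.restrict Ω), False := by
      filter_upwards [h0, ae_restrict_of_ae hoe] with y h2 h3
      rw [h3] at h2
      exact one_ne_zero h2
    rw [Filter.eventually_false_iff_eq_bot, ae_eq_bot, Measure.restrict_eq_zero] at h1
    exact hΩpos.ne' h1
  have hκ : WLS.kappa (WLS.weight μ ϱ) P (ϱ.restrict Ω) ≠ ∞ ∨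
      Real.log (3 * n / ε) ≤ 0 := by
    by_contra! h
    rw [h.1, ENNReal.mul_top (by simp), ENNReal.top_mul (by simpa using h.2)] at hm
    exact ENNReal.natCast_ne_top m (top_le_iff.1 hm)
  have hn1 : 1 ≤ n := by
    rw [← hn, Nat.one_le_iff_ne_zero]
    intro h0
    have := Module.finrank_zero_iff.1 h0
    have h1 : (⟨o, hoP⟩ : P) = 0 := Subsingleton.elim _ _
    have h2 : o = 0 := congrArg Subtype.val h1
    exact ho0 (by rw [h2]; simp)
  have hnR : (1 : ℝ) ≤ n := by exact_mod_cast hn1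
  set L := Real.log (3 * n / ε) with hLdef
  have hL : 0 < L := Real.log_pos (by rw [lt_div_iff₀ hε0]; linarith)
  have hκ' : WLS.kappa (WLS.weight μ ϱ) P (ϱ.restrict Ω) ≠ ∞ := hκ.resolve_right (not_le.2 hL)
  obtain ⟨r, a, ξ, hr, hξ, ha, hbound, hiso, hsamp⟩ := WLS.exists_sampling_vector hμϱ P hP
    (measurableSet_toMeasurable ϱ Ω) (by rwa [hres]) (by rwa [hres])
  rw [hres] at ha hbound
  set κ := (WLS.kappa (WLS.weight μ ϱ) P (ϱ.restrict Ω)).toReal with hκdef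
  have hκ1 : 1 ≤ κ := by
    refine WLS.one_le_of_isotropic hbound (b := a ⟨o, hoP⟩) ?_ (hiso _)
    intro h0
    have := ha ⟨o, hoP⟩
    rw [h0, enorm_zero] at this
    exact ho0 this
  have hmR : 8 * κ * L ≤ m := by
    have := ENNReal.toReal_mono (ENNReal.natCast_ne_top m) hm
    rwa [ENNReal.toReal_mul, ENNReal.toReal_mul, ENNReal.toReal_ofReal hL.le,
      ENNReal.toReal_natCast, ENNReal.toReal_ofNat] at this
  have hm0 : m ≠ 0 := by
    rintro rfl
    have : 0 < 8 * κ * L := by positivity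
    simp only [Nat.cast_zero] at hmR
    linarith
  have hε3 : 0 < ε / 3 := by positivity
  have hfnP := hfn.1
  have hffn : MemLp (f - fn) 2 ϱ := hf.sub (hP fn hfnP)
  have hξμ : IsProbabilityMeasure (μ.map ξ) := Measure.isProbabilityMeasure_map hξ.aemeasurable
  -- `B₀` is null and links coordinates to point values; `B₁`, `B₂`, `B₃` are the failures of the
  -- three events.
  let B₀ : Set S := {s | ¬ ∀ i, ∀ p : P,
    ‖inner ℂ (ξ (x i s)) (a p)‖ₑ ^ 2 ≤ WLS.weight μ ϱ (x i s) * ‖(p : D → ℂ) (x i s)‖ₑ ^ 2}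
  let B₁ : Set S := {s | ∃ b, ∑ i, ‖inner ℂ (ξ (x i s)) b‖ ^ 2 < 3 / 16 * m * ‖b‖ ^ 2}
  let B₂ : Set S := {s | (ENNReal.ofReal (ε / 3))⁻¹ * (m * eLpNorm (f - fn) 2 ϱ ^ 2) <
    ∑ i, WLS.weight μ ϱ (x i s) * ‖(f - fn) (x i s)‖ₑ ^ 2}
  let B₃ : Set S := {s | (ENNReal.ofReal (ε / 3))⁻¹ * (m * 1) < ∑ i, WLS.weight μ ϱ (x i s)}
  have hB₀ : Pr B₀ = 0 := by
    refine ae_iff.1 (ae_all_iff.2 fun i => ?_)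
    have h : ∀ᵐ y ∂(Pr.map (x i)), ∀ p : P,
        ‖inner ℂ (ξ y) (a p)‖ₑ ^ 2 ≤ WLS.weight μ ϱ y * ‖(p : D → ℂ) y‖ₑ ^ 2 := by
      rw [hlaw i]
      exact hsamp
    exact ae_of_ae_map (hx i) h
  have hB₁ : Pr B₁ ≤ ENNReal.ofReal (ε / 3) := by
    have h := WLS.measure_exists_sum_inner_lt_le (ν := μ.map ξ) hL hκ1
      ((ae_map_iff hξ.aemeasurable (measurableSet_le (by fun_prop) measurable_const)).2 hbound)
      (fun b => by
        rw [lintegral_map (by fun_prop) hξ]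
        exact hiso b) hmR Pr (fun i => ξ ∘ x i)
      (fun i => hξ.comp_aemeasurable (hx i))
      (fun i => by
        rw [← AEMeasurable.map_map_of_aemeasurable (by rw [hlaw i]; exact hξ.aemeasurable) (hx i),
          hlaw i])
      (hindep.comp (fun _ => ξ) fun _ => hξ)
    -- `r exp(-L) = r ε / (3n) ≤ ε / 3`, which is where the `3n` in the logarithm is spent.
    refine h.trans (ENNReal.ofReal_le_ofReal ?_)
    rw [hLdef, Real.exp_neg, Real.exp_log (by positivity), Fintype.card_fin, inv_div]
    have hrn : (r : ℝ) ≤ n := by rw [← hn]; exact_mod_cast hr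
    calc (r : ℝ) * (ε / (3 * n)) ≤ n * (ε / (3 * n)) := by gcongr
      _ = ε / 3 := by field_simp
  have hB₂ : Pr B₂ ≤ ENNReal.ofReal (ε / 3) := by
    have hg : AEMeasurable (fun y => ‖(f - fn) y‖ₑ ^ 2) ϱ := hffn.1.enorm.pow_const 2
    refine WLS.measure_sum_comp_gt_le hx hlaw (g := fun y => WLS.weight μ ϱ y * ‖(f - fn) y‖ₑ ^ 2)
      ((WLS.measurable_weight μ ϱ).aemeasurable.mul (hg.mono_ac hμϱ)) (ENNReal.pow_ne_top hffn.2.ne)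
      ((WLS.lintegral_weight_mul_le hμϱ hg).trans (le_of_eq ?_)) hε3
    rw [eLpNorm_eq_lintegral_rpow_enorm_toReal (by simp) (by simp)]
    simp only [ENNReal.toReal_ofNat, ENNReal.rpow_ofNat]
    rw [← ENNReal.rpow_natCast, ← ENNReal.rpow_mul]
    simp
  have hB₃ : Pr B₃ ≤ ENNReal.ofReal (ε / 3) := by
    refine WLS.measure_sum_comp_gt_le hx hlaw (g := WLS.weight μ ϱ)
      (WLS.measurable_weight μ ϱ).aemeasurable ENNReal.one_ne_top ?_ hε3
    have := WLS.lintegral_weight_mul_le hμϱ (g := fun _ => 1) aemeasurable_const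
    simpa using this
  have hB : Pr (B₀ ∪ (B₁ ∪ (B₂ ∪ B₃))) ≤ ENNReal.ofReal ε := by
    calc Pr (B₀ ∪ (B₁ ∪ (B₂ ∪ B₃))) ≤ Pr B₀ + (Pr B₁ + (Pr B₂ + Pr B₃)) := by
          refine (measure_union_le _ _).trans (add_le_add le_rfl ?_)
          refine (measure_union_le _ _).trans (add_le_add le_rfl ?_)
          exact measure_union_le _ _
      _ ≤ 0 + (ENNReal.ofReal (ε / 3) + (ENNReal.ofReal (ε / 3) + ENNReal.ofReal (ε / 3))) := by
          gcongr
          exact hB₀.le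
      _ = ENNReal.ofReal ε := by
          rw [zero_add, ← ENNReal.ofReal_add (by positivity) (by positivity),
            ← ENNReal.ofReal_add (by positivity) (by positivity)]
          congr 1; ring
  -- The bad set need not be measurable, so its measurable hull, of equal measure, is removed.
  refine ⟨(toMeasurable Pr (B₀ ∪ (B₁ ∪ (B₂ ∪ B₃))))ᶜ, (measurableSet_toMeasurable _ _).compl,
    ?_, ?_⟩
  · rw [prob_compl_eq_one_sub (measurableSet_toMeasurable _ _), measure_toMeasurable,
      ENNReal.ofReal_sub _ hε0.le, ENNReal.ofReal_one]
    gcongr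
  intro s hs e fhat hmin
  have hs' : s ∉ B₀ ∪ (B₁ ∪ (B₂ ∪ B₃)) := fun h => hs (subset_toMeasurable _ _ h)
  simp only [Set.mem_union, not_or] at hs'
  obtain ⟨h₀, h₁, h₂, h₃⟩ := hs'
  simp only [B₀, Set.mem_ofPred_eq, not_not] at h₀
  simp only [B₁, Set.mem_ofPred_eq, not_exists, not_lt] at h₁
  simp only [B₂, Set.mem_ofPred_eq, not_lt] at h₂
  simp only [B₃, Set.mem_ofPred_eq, not_lt, mul_one] at h₃
  have hdP : fhat - fn ∈ P := P.sub_mem hmin.1 hfnP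
  have hkey : eLpNorm (fhat - fn) 2 (ϱ.restrict Ω) ≤
      8 / ENNReal.ofReal (Real.sqrt ε) * (eLpNorm (f - fn) 2 ϱ + ‖e‖ₑ) := by
    refine WLS.le_eight_div_sqrt_mul hm0 hε0 ?_ (WLS.weightedNorm_sub_minimizer_le hm0 hmin hfnP) ?_ ?_
    · rw [WLS.weightedNorm_sq, ha ⟨fhat - fn, hdP⟩]
      refine le_trans ?_ (Finset.sum_le_sum fun i _ => h₀ i ⟨fhat - fn, hdP⟩)
      have h4 := ENNReal.ofReal_le_ofReal (h₁ (a ⟨fhat - fn, hdP⟩))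
      rw [ENNReal.ofReal_mul (by positivity), ENNReal.ofReal_sum_of_nonneg
        fun _ _ => by positivity] at h4
      simpa only [ENNReal.ofReal_pow (norm_nonneg _), ofReal_norm] using h4
    · rw [WLS.weightedNorm_sq]
      exact h₂
    · refine (WLS.weightedNorm_le_mul_enorm _ e).trans ?_
      gcongr
  exact ⟨fun hR => WLS.eLpNorm_sub_le_of_remez hP ⟨o, hoP, hoe⟩ hΩpos one_le_two hR hf hfnP hmin.1 hkey,
    fun hR => WLS.eLpNorm_sub_le_of_remez hP ⟨o, hoP, hoe⟩ hΩpos le_top hR hf hfnP hmin.1 hkey⟩
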